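/- Let $\mathbb K=\mathbb R$ or $\mathbb C$, let $r$ be $\infty$ or $\omega$ (smooth or analytic), and let $M_*$ be an $n$-dimensional manifold of class $C^r$ over $\mathbb K$ (holomorphic if $\mathbb K=\mathbb C$). Let $d\in\mathbb K$, $d\neq 1$. A \emph{Frobenius algebra} is a commutative associative algebra with unity and with a symmetric nondegenerate bilinear form that is invariant: $\langle x\cdot y,z\rangle=\langle x,y\cdot z\rangle$. A \emph{Frobenius structure of charge $d$} on a manifold is a structure $(\cdot,\langle\ ,\ \rangle)$ of a Frobenius algebra on the tangent spaces, depending $C^r$ on the point, with unity field $e$, such that, with $\nabla$ the Levi-Civita connection of $\langle\ ,\ \rangle$: (FM1) $\langle\ ,\ \rangle$ is flat and $\nabla e=0$; (FM2) for $c(x,y,z)=\langle x\cdot y,z\rangle$ the 4-tensor $(\nabla_w c)(x,y,z)$ is symmetric in $x,y,z,w$; (FM3) there is given a vector field $E$ (the Euler vector field) with $\nabla\nabla E=0$ and $$[E,x\cdot y]-[E,x]\cdot y-x\cdot[E,y]=x\cdot y,\qquad E\langle x,y\rangle-\langle[E,x],y\rangle-\langle x,[E,y]\rangle=(2-d)\langle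 x,y\rangle$$ for all vector fields $x,y$. An \emph{almost Frobenius structure of charge $d$} on $M_*$ is a structure $(*,(\ ,\ ))$ of a Frobenius algebra on the tangent spaces of $M_*$, with unity field $E$, depending $C^r$ on the point, such that around every point there are local coordinates $p^1,\dots,p^n$ with the following properties. (AFM1) The Gram matrix $G_{ij}=(\partial_i,\partial_j)$ is constant, where $\partial_i=\partial/\partial p^i$; let $(G^{ij})$ be the inverse matrix. (AFM2) There is a function $F_*(p)$ with $\partial_i*\partial_j=\overset{*}{c}{}_{ij}^k\,\partial_k$, $\ \overset{*}{c}{}_{ij}^k=G^{kl}\,\partial_l\partial_i\partial_jF_*$, and $$\sum_i p^i\,\partial_iF_*=2F_*+\frac1{1-d}\,G_{ij}p^ip^j .$$ Moreover $E=\frac{1-d}2\sum_i p^i\partial_i$. (AFM3) There is given a $C^r$ vector field $e$ on $M_*$, invertible in the algebra $(T_pM_*,*)$ at every point, such that the operator $\tilde p\mapsto e\tilde p$ acts as the shift $\nu\mapsto\nu-1$ on the twisted periods, i.e. on the local solutions of $$\partial_i\partial_j\tilde p=\nu\,\overset{*}{c}{}_{ij}^k\,\partial_k\tilde p ,$$ in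 the following sense: (a) for every $\nu\in\mathbb K$ it takes twisted periods with parameter $\nu$ to twisted periods with parameter $\nu-1$; (b) it changes the sign of the invariant pairing of twisted periods with opposite parameters: if $\tilde p$ and $\tilde q$ are twisted periods with parameters $\nu$ and $1-\nu$ on the same open set, then $$G^{ij}\,\partial_i(e\tilde p)\,\partial_j\tilde q=-\,G^{ij}\,\partial_i\tilde p\;\partial_j(e\tilde q).$$ \textbf{Theorem (Reconstruction Theorem).} Given an almost Frobenius structure of charge $d\ne1$ on $M_*$, define on the tangent spaces $$u\cdot v:=\frac{u*v}{e},\qquad \langle u,v\rangle:=\Bigl(u,\frac ve\Bigr),$$ where division by $e$ is with respect to the multiplication $*$. Then $(\cdot,\langle\ ,\ \rangle)$ is a Frobenius structure of charge $d$ on $M_*$ with unity $e$ and Euler vector field $E$. This inverts the almost duality: $E$ is invertible in $(T_pM_*,\cdot)$ at every point, and $u*v=\dfrac{u\cdot v}{E}$, $\ (u,v)=\Bigl\langle u,\dfrac vE\Bigr\rangle$, where division by $E$ is with respect to the multiplication $\cdot$. -/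

import Mathlib

open scoped Manifold ContDiff

noncomputable section

namespace AlmostDuality

/-! ### Frobenius algebras and division by an element -/

section Algebra

variable {𝕜 A : Type*} [NontriviallyNormedField 𝕜] [AddCommGroup A] [Module 𝕜 A]
  [TopologicalSpace A] [IsTopologicalAddGroup A] [ContinuousConstSMul 𝕜 A]

/-- `mul` is the product of a commutative associative algebra on `A` with unity `one`, and `form` is
a symmetric nondegenerate invariant bilinear form on it. -/
structure IsFrobeniusAlgebra (mul : A →L[𝕜] A →L[𝕜] A) (form : A →L[𝕜] A →L[𝕜] 𝕜) (one : A) :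
    Prop where
  mul_comm : ∀ x y, mul x y = mul y x
  mul_assoc : ∀ x y z, mul (mul x y) z = mul x (mul y z)
  one_mul : ∀ x, mul one x = x
  form_symm : ∀ x y, form x y = form y x
  form_nondegenerate : ∀ x, (∀ y, form x y = 0) → x = 0
  form_invariant : ∀ x y z, form (mul x y) z = form x (mul y z)

/-- `v ↦ v / a`: the inverse of the multiplication by `a` (and `0` if that is not invertible). -/
def divBy (mul : A →L[𝕜] A →L[𝕜] A) (a : A) : A →L[𝕜] A := (mul a).inverse

/-- If `a` has an inverse `b`, then `v / a` is the product of `b` and `v`. -/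
theorem divBy_eq_mul {mul : A →L[𝕜] A →L[𝕜] A} {one a b : A}
    (mul_comm : ∀ x y, mul x y = mul y x) (mul_assoc : ∀ x y z, mul (mul x y) z = mul x (mul y z))
    (one_mul : ∀ x, mul one x = x) (hab : mul a b = one) (v : A) :
    divBy mul a v = mul b v := by
  have h1 : Function.LeftInverse (mul b) (mul a) := fun x => by
    rw [← mul_assoc, mul_comm b a, hab, one_mul]
  have h2 : Function.RightInverse (mul b) (mul a) := fun x => by
    rw [← mul_assoc, hab, one_mul]
  have h3 : mul a = (ContinuousLinearEquiv.equivOfInverse (mul a) (mul b) h1 h2 : A →L[𝕜] A) := by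
    ext x; rfl
  unfold divBy
  rw [h3, ContinuousLinearMap.inverse_equiv]
  rfl

/-- The product `(u, v) ↦ (u v) / a`. -/
def quotMul (mul : A →L[𝕜] A →L[𝕜] A) (a : A) : A →L[𝕜] A →L[𝕜] A :=
  (ContinuousLinearMap.postcomp A (divBy mul a)).comp mul

/-- The bilinear form `(u, v) ↦ form (u, v / a)`. -/
def quotForm (mul : A →L[𝕜] A →L[𝕜] A) (form : A →L[𝕜] A →L[𝕜] 𝕜) (a : A) :
    A →L[𝕜] A →L[𝕜] 𝕜 :=
  (ContinuousLinearMap.precomp 𝕜 (divBy mul a)).comp form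

theorem quotMul_apply (mul : A →L[𝕜] A →L[𝕜] A) (a u v : A) :
    quotMul mul a u v = divBy mul a (mul u v) := rfl

theorem quotForm_apply (mul : A →L[𝕜] A →L[𝕜] A) (form : A →L[𝕜] A →L[𝕜] 𝕜) (a u v : A) :
    quotForm mul form a u v = form u (divBy mul a v) := rfl

end Algebra

/-! ### Tensor calculus on an open subset of the model space -/

section Local

variable {𝕜 V : Type*} [RCLike 𝕜] [NormedAddCommGroup V] [NormedSpace 𝕜 V]

/-- The Levi-Civita connection of the metric `g` in coordinates, `Γ(u, v) = ∇_u v` for constant `u`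
and `v`, given by `g(Γ(u, v), w) = (D_u g(v, w) + D_v g(u, w) - D_w g(u, v)) / 2`. -/
def christoffel (g : V → V →L[𝕜] V →L[𝕜] 𝕜) (y u v : V) : V :=
  (g y).inverse ((2⁻¹ : 𝕜) •
    (fderiv 𝕜 g y u v + fderiv 𝕜 g y v u - ((fderiv 𝕜 g y).flip u).flip v))

/-- The curvature `R(u, v) w` of the Levi-Civita connection of `g`. -/
def curvature (g : V → V →L[𝕜] V →L[𝕜] 𝕜) (y u v w : V) : V :=
  fderiv 𝕜 (fun z => christoffel g z v w) y u - fderiv 𝕜 (fun z => christoffel g z u w) y v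
    + christoffel g y u (christoffel g y v w) - christoffel g y v (christoffel g y u w)

/-- The covariant derivative `∇_u X` at `y` of a vector field `X`. -/
def covDeriv (g : V → V →L[𝕜] V →L[𝕜] 𝕜) (X : V → V) (y u : V) : V :=
  fderiv 𝕜 X y u + christoffel g y u (X y)

/-- The second covariant derivative `(∇∇X)(u, v) = (∇_u (∇X))(v)` at `y` of a vector field `X`. -/
def covDerivTwo (g : V → V →L[𝕜] V →L[𝕜] 𝕜) (X : V → V) (y u v : V) : V :=
  fderiv 𝕜 (fun z => covDeriv g X z v) y u + christoffel g y u (covDeriv g X y v)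
    - covDeriv g X y (christoffel g y u v)

/-- The tensor `c(a, b, c) = g(a · b, c)`. -/
def tensorC (g : V → V →L[𝕜] V →L[𝕜] 𝕜) (mul : V → V →L[𝕜] V →L[𝕜] V) (y a b c : V) : 𝕜 :=
  g y (mul y a b) c

/-- The covariant derivative `(∇_w c)(a, b, c)` of the tensor `c`. -/
def nablaC (g : V → V →L[𝕜] V →L[𝕜] 𝕜) (mul : V → V →L[𝕜] V →L[𝕜] V) (y w a b c : V) : 𝕜 :=
  fderiv 𝕜 (fun z => tensorC g mul z a b c) y w
    - tensorC g mul y (christoffel g y w a) b c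
    - tensorC g mul y a (christoffel g y w b) c
    - tensorC g mul y a b (christoffel g y w c)

/-- The differential axioms of a Frobenius structure of charge `d`, with metric `g`, product `mul`,
unity `e` and Euler vector field `E`, on an open subset `U` of the model space; `r` is the order of
differentiability. -/
structure IsFrobeniusOn (r : ℕ∞ω) (d : 𝕜) (U : Set V) (g : V → V →L[𝕜] V →L[𝕜] 𝕜)
    (mul : V → V →L[𝕜] V →L[𝕜] V) (e E : V → V) : Prop where
  contDiffOn_form : ContDiffOn 𝕜 r g U
  contDiffOn_mul : ContDiffOn 𝕜 r mul U
  contDiffOn_unit : ContDiffOn 𝕜 r e U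
  contDiffOn_euler : ContDiffOn 𝕜 r E U
  /-- The metric is flat. -/
  flat : ∀ y ∈ U, ∀ u v w, curvature g y u v w = 0
  /-- The unity is flat. -/
  unit_flat : ∀ y ∈ U, ∀ u, covDeriv g e y u = 0
  /-- The 4-tensor `∇c` is invariant under adjacent transpositions, hence symmetric. -/
  nablaC_symm : ∀ y ∈ U, ∀ w a b c,
    nablaC g mul y w a b c = nablaC g mul y a w b c ∧
    nablaC g mul y w a b c = nablaC g mul y w b a c ∧
    nablaC g mul y w a b c = nablaC g mul y w a c b
  /-- The Euler vector field is linear, `∇∇E = 0`. -/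
  euler_linear : ∀ y ∈ U, ∀ u v, covDerivTwo g E y u v = 0
  /-- `[E, X · Y] - [E, X] · Y - X · [E, Y] = X · Y`. -/
  euler_mul : ∀ X Y : V → V, ContDiffOn 𝕜 r X U → ContDiffOn 𝕜 r Y U → ∀ y ∈ U,
    VectorField.lieBracket 𝕜 E (fun z => mul z (X z) (Y z)) y
      - mul y (VectorField.lieBracket 𝕜 E X y) (Y y)
      - mul y (X y) (VectorField.lieBracket 𝕜 E Y y) = mul y (X y) (Y y)
  /-- `E⟨X, Y⟩ - ⟨[E, X], Y⟩ - ⟨X, [E, Y]⟩ = (2 - d) ⟨X, Y⟩`. -/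
  euler_form : ∀ X Y : V → V, ContDiffOn 𝕜 r X U → ContDiffOn 𝕜 r Y U → ∀ y ∈ U,
    fderiv 𝕜 (fun z => g z (X z) (Y z)) y (E y)
      - g y (VectorField.lieBracket 𝕜 E X y) (Y y)
      - g y (X y) (VectorField.lieBracket 𝕜 E Y y) = (2 - d) * g y (X y) (Y y)

/-- `p` is a twisted period on `W` with parameter `ν`, that is, a solution of
`∂²p / ∂p^i ∂p^j = ν c_{ij}^k ∂p / ∂p^k`, where `c_{ij}^k` are the structure constants of `mul`
(a solution of class `C^2` is automatically as smooth as `mul`). -/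
def IsTwistedPeriod (mul : V → V →L[𝕜] V →L[𝕜] V) (ν : 𝕜) (W : Set V) (p : V → 𝕜) :
    Prop :=
  ContDiffOn 𝕜 2 p W ∧
    ∀ y ∈ W, ∀ u v, fderiv 𝕜 (fun z => fderiv 𝕜 p z v) y u = ν * fderiv 𝕜 p y (mul y u v)

/-- The derivative `e p` of a function `p` along a vector field `e`. -/
def along (e : V → V) (p : V → 𝕜) (y : V) : 𝕜 := fderiv 𝕜 p y (e y)

/-- The bilinear form on covectors that corresponds to a nondegenerate bilinear form `G` on vectors:
in coordinates, `G^{ij} α_i β_j` with the matrix `G^{ij}` inverse to the Gram matrix of `G`. -/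
def cometric (G : V →L[𝕜] V →L[𝕜] 𝕜) (α β : V →L[𝕜] 𝕜) : 𝕜 := α (G.inverse β)

/-- The axioms of an almost Frobenius structure of charge `d` on an open set `U` of values of flat
coordinates, in which the metric is the constant form `G`; `star` is the product, `E` its unity and
`e` the vector field of the shift; `r` is the order of differentiability. -/
structure IsAlmostFrobeniusOn (r : ℕ∞ω) (d : 𝕜) (U : Set V) (G : V →L[𝕜] V →L[𝕜] 𝕜)
    (star : V → V →L[𝕜] V →L[𝕜] V) (E e : V → V) : Prop where
  contDiffOn_mul : ContDiffOn 𝕜 r star U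
  contDiffOn_shift : ContDiffOn 𝕜 r e U
  /-- The structure constants are the third derivatives of a function that is homogeneous in the
  sense that `∑ p^i ∂F / ∂p^i = 2 F + (p, p) / (1 - d)`. -/
  potential : ∃ F : V → 𝕜, ContDiffOn 𝕜 r F U ∧
    (∀ y ∈ U, ∀ u v w, G (star y u v) w = iteratedFDeriv 𝕜 3 F y ![u, v, w]) ∧
    ∀ y ∈ U, fderiv 𝕜 F y y = 2 * F y + 1 / (1 - d) * G y y
  /-- `E = (1 - d) / 2 ∑ p^i ∂ / ∂p^i`. -/
  euler : ∀ y ∈ U, E y = ((1 - d) / 2) • y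
  /-- `p ↦ e p` takes twisted periods with parameter `ν` to twisted periods with parameter
  `ν - 1`. -/
  shift : ∀ W ⊆ U, IsOpen W → ∀ (ν : 𝕜) (p : V → 𝕜),
    IsTwistedPeriod star ν W p → IsTwistedPeriod star (ν - 1) W (along e p)
  /-- The shift changes the sign of the pairing between twisted periods with opposite parameters:
  `(ξ(ν - 1), ξ(1 - ν)) = - (ξ(ν), ξ(-ν))`, where `ξ(ν)` and `ξ(1 - ν)` are the gradients of `p`
  and `q`, and the shift takes them to `ξ(ν - 1)` and `ξ(-ν)`. -/
  shift_pairing : ∀ W ⊆ U, IsOpen W → ∀ (ν : 𝕜) (p q : V → 𝕜),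
    IsTwistedPeriod star ν W p → IsTwistedPeriod star (1 - ν) W q → ∀ y ∈ W,
    cometric G (fderiv 𝕜 (along e p) y) (fderiv 𝕜 q y)
      = - cometric G (fderiv 𝕜 p y) (fderiv 𝕜 (along e q) y)

end Local

/-! ### Structures on a manifold -/

section Global

variable {𝕜 V M : Type*} [RCLike 𝕜] [NormedAddCommGroup V] [NormedSpace 𝕜 V]
  [TopologicalSpace M] [ChartedSpace V M]

/-- The expression of a vector field in the chart `φ`. -/
def chartVec (φ : OpenPartialHomeomorph M V) (X : ∀ x : M, TangentSpace 𝓘(𝕜, V) x) (y : V) : V :=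
  mfderiv 𝓘(𝕜, V) 𝓘(𝕜, V) φ (φ.symm y) (X (φ.symm y))

/-- The expression in the chart `φ` of a field of bilinear forms on the tangent spaces. -/
def chartForm (φ : OpenPartialHomeomorph M V)
    (g : ∀ x : M, TangentSpace 𝓘(𝕜, V) x →L[𝕜] TangentSpace 𝓘(𝕜, V) x →L[𝕜] 𝕜) (y : V) :
    V →L[𝕜] V →L[𝕜] 𝕜 :=
  let D : V →L[𝕜] TangentSpace 𝓘(𝕜, V) (φ.symm y) := mfderiv 𝓘(𝕜, V) 𝓘(𝕜, V) φ.symm y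
  (ContinuousLinearMap.precomp 𝕜 D).comp ((g (φ.symm y)).comp D)

/-- The expression in the chart `φ` of a field of bilinear products on the tangent spaces. -/
def chartMul (φ : OpenPartialHomeomorph M V)
    (mul : ∀ x : M, TangentSpace 𝓘(𝕜, V) x →L[𝕜] TangentSpace 𝓘(𝕜, V) x →L[𝕜]
      TangentSpace 𝓘(𝕜, V) x) (y : V) :
    V →L[𝕜] V →L[𝕜] V :=
  let D : V →L[𝕜] TangentSpace 𝓘(𝕜, V) (φ.symm y) := mfderiv 𝓘(𝕜, V) 𝓘(𝕜, V) φ.symm y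
  let D' : TangentSpace 𝓘(𝕜, V) (φ.symm y) →L[𝕜] V := mfderiv 𝓘(𝕜, V) 𝓘(𝕜, V) φ (φ.symm y)
  (ContinuousLinearMap.postcomp V D').comp
    ((ContinuousLinearMap.precomp (TangentSpace 𝓘(𝕜, V) (φ.symm y)) D).comp
      ((mul (φ.symm y)).comp D))

/-- Frobenius structure of charge `d` on the manifold `M`, of class `C^r`, with metric `g`, product
`mul`, unity `e` and Euler vector field `E`. The differential axioms are tensorial, so they do not
depend on the chart in which they are written. -/
structure IsFrobeniusStructure (r : ℕ∞ω) (d : 𝕜)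
    (g : ∀ x : M, TangentSpace 𝓘(𝕜, V) x →L[𝕜] TangentSpace 𝓘(𝕜, V) x →L[𝕜] 𝕜)
    (mul : ∀ x : M, TangentSpace 𝓘(𝕜, V) x →L[𝕜] TangentSpace 𝓘(𝕜, V) x →L[𝕜]
      TangentSpace 𝓘(𝕜, V) x)
    (e E : ∀ x : M, TangentSpace 𝓘(𝕜, V) x) : Prop where
  frobenius_algebra : ∀ x, IsFrobeniusAlgebra (mul x) (g x) (e x)
  differential_axioms : ∀ x, ∃ φ ∈ IsManifold.maximalAtlas 𝓘(𝕜, V) r M, x ∈ φ.source ∧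
    IsFrobeniusOn r d φ.target (chartForm φ g) (chartMul φ mul) (chartVec φ e) (chartVec φ E)

/-- Almost Frobenius structure of charge `d` on the manifold `M`, of class `C^r`, with metric `g`,
product `star`, unity (= Euler vector field) `E`, and `e` the invertible vector field that acts on
twisted periods by the shift. The chart `φ` around each point is a system of flat coordinates. -/
structure IsAlmostFrobeniusStructure (r : ℕ∞ω) (d : 𝕜)
    (g : ∀ x : M, TangentSpace 𝓘(𝕜, V) x →L[𝕜] TangentSpace 𝓘(𝕜, V) x →L[𝕜] 𝕜)
    (star : ∀ x : M, TangentSpace 𝓘(𝕜, V) x →L[𝕜] TangentSpace 𝓘(𝕜, V) x →L[𝕜]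
      TangentSpace 𝓘(𝕜, V) x)
    (E e : ∀ x : M, TangentSpace 𝓘(𝕜, V) x) : Prop where
  frobenius_algebra : ∀ x, IsFrobeniusAlgebra (star x) (g x) (E x)
  shift_invertible : ∀ x, ∃ b, star x (e x) b = E x
  flat_coordinates : ∀ x, ∃ φ ∈ IsManifold.maximalAtlas 𝓘(𝕜, V) r M, x ∈ φ.source ∧
    ∃ G : V →L[𝕜] V →L[𝕜] 𝕜, (∀ y ∈ φ.target, chartForm φ g y = G) ∧
      IsAlmostFrobeniusOn r d φ.target G (chartMul φ star) (chartVec φ E) (chartVec φ e)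

end Global

end AlmostDuality

end

/-! In flat coordinates of the metric `G` the unity is `E = κ y` with `κ = (1 - d) / 2`. Write `De`
for the differential of `e`. That the shift sends a period `p` to a period expands, at each point,
to `dp(...) = 0` for an explicit vector; once `dp` can be prescribed there, the vector vanishes. For
`ν = 0` linear functions suffice and give `D²e(u, v) = -De(u * v)`. One generic `ν` gives a
Leibniz-type rule tying `De` to the differential of `*`, and the pairing condition gives `G(De u, v)
+ G(u, De v) = -G(u * v, e)`. With the symmetry of the differential of `*` (third derivatives of a
potential) these are the `ShiftIdentities`, and they are all that is needed about periods.

Enough periods exist because the gradient system `D_u ξ = ν u * ξ` is integrable: multiplications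
commute and the differential of `*` is symmetric (`exists_local_solution`). The function is
recovered from its gradient through `E` (`exists_isTwistedPeriod`).

For the quotient product and form, the identities make `∇_u v = D_u v - De(u · v)` metric; it is
torsion-free since `·` is commutative, hence Levi-Civita (`IsShiftQuotient.christoffel_eq`). Then
`∇_u e = De u - De(u · e) = 0`, and both flatness and the symmetry of `∇c` reduce to one formula,
`IsShiftQuotient.fderiv_mul_sub_fderiv_mul`. The Euler axioms follow from `E = κ y` being the unity
of `*`. The inversion of the duality is pure algebra: `e * e` is the inverse of `E` for `·`. -/

noncomputable section

namespace AlmostDuality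

/-! ### Local solutions of integrable linear systems, via a Volterra equation on rays. -/

section Existence

open Set Filter Topology unitInterval BoundedContinuousFunction

variable {𝕜 V X F K : Type*} [RCLike 𝕜] [NormedAddCommGroup V] [NormedSpace 𝕜 V]
  [NormedAddCommGroup X] [NormedSpace 𝕜 X] [NormedAddCommGroup F] [NormedSpace 𝕜 F]
  [TopologicalSpace K] [CompactSpace K]

/-- A continuous family of linear maps, as a linear map into the continuous functions. -/
def evalFamily (c : K →ᵇ (V →L[𝕜] F)) : V →L[𝕜] (K →ᵇ F) :=
  LinearMap.mkContinuous
    { toFun := fun h => mkOfCompact ⟨fun s => c s h, c.continuous.clm_apply continuous_const⟩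
      map_add' := fun x y => by ext s; simp
      map_smul' := fun a x => by ext s; simp } ‖c‖ (fun h => by
    refine (BoundedContinuousFunction.norm_le (by positivity)).2 fun s => ?_
    exact (c s).le_of_opNorm_le (c.norm_coe_le_norm s) h)

@[simp] theorem evalFamily_apply (c : K →ᵇ (V →L[𝕜] F)) (h : V) (s : K) :
    evalFamily c h s = c s h := rfl

/-- Differentiability of a family of functions with respect to the parameter, uniformly over a
compact space. -/
theorem hasFDerivAt_mkD {f : K → V → F} {f' : K → V → V →L[𝕜] F} {U : Set V} {v₀ : V}
    (hU : U ∈ 𝓝 v₀) (hf : ∀ s, ∀ v ∈ U, HasFDerivAt (f s) (f' s v) v)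
    (hc : ∀ v ∈ U, Continuous fun s => f s v)
    (hc' : ∀ s, ContinuousAt (Function.uncurry f') (s, v₀)) (c : K →ᵇ (V →L[𝕜] F))
    (hcf : ∀ s, c s = f' s v₀) :
    HasFDerivAt (fun v => mkOfCompact (ContinuousMap.mkD (fun s => f s v) 0)) (evalFamily c) v₀ := by
  let _ : NormedSpace ℝ V := NormedSpace.restrictScalars ℝ 𝕜 V
  rw [hasFDerivAt_iff_isLittleO, Asymptotics.isLittleO_iff]
  intro ε hε
  -- Compactness of `K` makes one neighbourhood of `v₀` serve all `s`; the mean value inequality for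
  -- each `s` then gives a uniform remainder.
  have h1 : ∀ᶠ v in 𝓝 v₀, ∀ s : K, ‖f' s v - f' s v₀‖ ≤ ε := by
    have := isCompact_univ (X := K).eventually_forall_of_forall_eventually
      (x₀ := v₀) (P := fun v s => ‖f' s v - f' s v₀‖ ≤ ε) (fun s _ => by
        have h2 : ContinuousAt (fun z : V × K => f' z.2 z.1) (v₀, s) :=
          ContinuousAt.comp (g := Function.uncurry f') (f := fun z : V × K => (z.2, z.1))
            (x := (v₀, s)) (hc' s) (by fun_prop)
        have h3 : ContinuousAt (fun z : V × K => f' z.2 v₀) (v₀, s) := by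
          have : (fun z : V × K => f' z.2 v₀) = fun z => c z.2 := funext fun z => (hcf z.2).symm
          rw [this]; exact (c.continuous.comp continuous_snd).continuousAt
        have h4 : ContinuousAt (fun z : V × K => ‖f' z.2 z.1 - f' z.2 v₀‖) (v₀, s) :=
          (h2.sub h3).norm
        exact (h4.eventually_lt continuousAt_const (by simpa using hε)).mono fun z hz => hz.le)
    simpa using this
  obtain ⟨δ, hδ, hball⟩ := Metric.eventually_nhds_iff_ball.1 (h1.and hU)
  filter_upwards [Metric.ball_mem_nhds v₀ hδ] with v hv
  have hv₀ := Metric.mem_ball_self (x := v₀) hδ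
  refine (BoundedContinuousFunction.norm_le (by positivity)).2 fun s => ?_
  simp only [BoundedContinuousFunction.sub_apply, evalFamily_apply, hcf, mkOfCompact_apply,
    ContinuousMap.mkD_apply_of_continuous (hc v (hball v hv).2),
    ContinuousMap.mkD_apply_of_continuous (hc v₀ (hball v₀ hv₀).2)]
  exact (convex_ball v₀ δ).norm_image_sub_le_of_norm_hasFDerivWithin_le'
    (𝕜 := 𝕜) (fun z hz => (hf s z (hball z hz).2).hasFDerivWithinAt) (fun z hz => (hball z hz).1 s)
    hv₀ hv

/-- Pointwise application of a continuous family of operators. -/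
def applyFamily : (K →ᵇ (X →L[𝕜] X)) →L[𝕜] (K →ᵇ X) →L[𝕜] (K →ᵇ X) :=
  LinearMap.mkContinuous₂
    (LinearMap.mk₂ 𝕜 (fun (a : (K →ᵇ (X →L[𝕜] X))) (f : (K →ᵇ X)) =>
        (mkOfCompact ⟨fun s => a s (f s), a.continuous.clm_apply f.continuous⟩ : K →ᵇ X))
      (fun a a' f => by ext s; simp) (fun r a f => by ext s; simp)
      (fun a f f' => by ext s; simp) (fun r a f => by ext s; simp)) 1 (fun a f => by
    rw [one_mul]
    refine (BoundedContinuousFunction.norm_le (by positivity)).2 fun s => ?_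
    exact (a s).le_of_opNorm_le_of_le (a.norm_coe_le_norm s) (f.norm_coe_le_norm s))

@[simp] theorem applyFamily_apply (a : (K →ᵇ (X →L[𝕜] X))) (f : (K →ᵇ X)) (s : K) :
    applyFamily (𝕜 := 𝕜) a f s = a s (f s) := rfl

section Volterra

theorem continuous_IccExtend_coe (f : (I →ᵇ X)) : Continuous (IccExtend zero_le_one f : ℝ → X) :=
  f.continuous.Icc_extend'

variable [NormedSpace ℝ X] [IsScalarTower ℝ 𝕜 X]

variable (𝕜) in
/-- The integration operator `f ↦ ∫₀ᵗ f`. -/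
def volterra : (I →ᵇ X) →L[𝕜] (I →ᵇ X) :=
  LinearMap.mkContinuous
    { toFun := fun f => mkOfCompact ⟨fun t => ∫ s in (0:ℝ)..t, IccExtend zero_le_one f s,
        (intervalIntegral.continuous_primitive
          (fun a b => (continuous_IccExtend_coe f).intervalIntegrable a b) 0).comp
          continuous_subtype_val⟩
      map_add' := fun f g => by
        ext t
        simp only [mkOfCompact_apply, ContinuousMap.coe_mk, BoundedContinuousFunction.add_apply]
        rw [← intervalIntegral.integral_add
          ((continuous_IccExtend_coe f).intervalIntegrable _ _)
          ((continuous_IccExtend_coe g).intervalIntegrable _ _)]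
        rfl
      map_smul' := fun r f => by
        ext t
        simp only [mkOfCompact_apply, ContinuousMap.coe_mk, BoundedContinuousFunction.smul_apply,
          RingHom.id_apply]
        rw [← intervalIntegral.integral_smul]
        rfl } 1 (fun f => by
    refine (BoundedContinuousFunction.norm_le (by positivity)).2 fun t => ?_
    refine (intervalIntegral.norm_integral_le_of_norm_le_const (C := ‖f‖)
      fun s _ => f.norm_coe_le_norm _).trans ?_
    rw [sub_zero, abs_of_nonneg t.2.1, one_mul]
    exact mul_le_of_le_one_right (norm_nonneg _) t.2.2)

theorem volterra_apply (f : (I →ᵇ X)) (t : I) :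
    volterra 𝕜 f t = ∫ s in (0:ℝ)..t, IccExtend zero_le_one f s := rfl

/-- The fundamental theorem of calculus; it lets an explicitly guessed solution of a Volterra
equation be checked by differentiation. -/
theorem volterra_eq_sub [CompleteSpace X] (f : (I →ᵇ X)) (φ : ℝ → X)
    (h : ∀ s : I, HasDerivAt φ (f s) s) (t : I) : volterra 𝕜 f t = φ t - φ 0 := by
  rw [volterra_apply]
  refine intervalIntegral.integral_eq_sub_of_hasDerivAt (fun s hs => ?_)
    ((continuous_IccExtend_coe f).intervalIntegrable _ _)
  rw [uIcc_of_le t.2.1] at hs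
  have hs' : s ∈ Icc (0:ℝ) 1 := ⟨hs.1, hs.2.trans t.2.2⟩
  rw [IccExtend_of_mem zero_le_one f hs']
  exact h ⟨s, hs'⟩

theorem hasDerivAt_volterra [CompleteSpace X] (f : (I →ᵇ X)) (s : I) :
    HasDerivAt (fun t : ℝ => ∫ s in (0:ℝ)..t, IccExtend zero_le_one f s) (f s) s := by
  have h := intervalIntegral.integral_hasDerivAt_right
    ((continuous_IccExtend_coe f).intervalIntegrable 0 s)
    ((continuous_IccExtend_coe f).stronglyMeasurableAtFilter _ _)
    (continuous_IccExtend_coe f).continuousAt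
  rwa [IccExtend_val] at h

end Volterra

/-- Solution of `(1 - Φ(a(v))) γ(v) = x` near a zero of `a`, with a characterization of its
differential. -/
theorem exists_resolvent_family {Y Z : Type*} [NormedAddCommGroup Y] [NormedSpace 𝕜 Y]
    [CompleteSpace Y] [NormedAddCommGroup Z] [NormedSpace 𝕜 Z] (Φ : Z →L[𝕜] Y →L[𝕜] Y) {a : V → Z}
    {a' : V → V →L[𝕜] Z} {B : Set V} (hB : IsOpen B) (h0B : (0 : V) ∈ B)
    (ha : ∀ v ∈ B, HasFDerivAt a (a' v) v) (ha0 : a 0 = 0) (x : Y) :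
    ∃ N ⊆ B, IsOpen N ∧ (0 : V) ∈ N ∧ ∃ γ : V → Y, γ 0 = x ∧ ∀ v ∈ N,
      DifferentiableAt 𝕜 γ v ∧ γ v - Φ (a v) (γ v) = x ∧
      ∀ u ε, Φ (a v) ε + Φ (a' v u) (γ v) = ε → fderiv 𝕜 γ v u = ε := by
  have hT : ∀ v ∈ B, HasFDerivAt (fun v => Φ (a v)) (Φ.comp (a' v)) v := fun v hv =>
    Φ.hasFDerivAt.comp v (ha v hv)
  -- Invertibility of operators on a Banach space is an open condition and holds at `v = 0`, where
  -- `1 - Φ (a v)` is the identity.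
  let N : Set V := B ∩ (fun v => 1 - Φ (a v)) ⁻¹' {t | IsUnit t}
  have hN : IsOpen N :=
    ContinuousOn.isOpen_inter_preimage
      (fun v hv => ((hT v hv).const_sub 1).continuousAt.continuousWithinAt) hB Units.isOpen
  have h0N : (0 : V) ∈ N := ⟨h0B, by simp [ha0]⟩
  let γ : V → Y := fun v => Ring.inverse (1 - Φ (a v)) x
  have hγ : ∀ v ∈ N, γ v - Φ (a v) (γ v) = x := fun v hv => by
    have := congrArg (fun t : Y →L[𝕜] Y => t x) (Ring.mul_inverse_cancel (1 - Φ (a v)) hv.2)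
    simpa [γ] using this
  have hinj : ∀ v ∈ N, ∀ δ, δ - Φ (a v) δ = 0 → δ = 0 := fun v hv δ h => by
    have := congrArg (fun t : Y →L[𝕜] Y => t δ) (Ring.inverse_mul_cancel (1 - Φ (a v)) hv.2)
    simpa [h] using this.symm
  have hγd : ∀ v ∈ N, DifferentiableAt 𝕜 γ v := fun v hv => by
    obtain ⟨t, ht⟩ := hv.2
    have h2 : DifferentiableAt 𝕜 Ring.inverse (1 - Φ (a v)) := by
      change DifferentiableAt 𝕜 Ring.inverse ((fun v => 1 - Φ (a v)) v)
      rw [← ht]; exact (hasFDerivAt_ringInverse t).differentiableAt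
    exact (DifferentiableAt.comp v h2 ((hT v hv.1).const_sub 1).differentiableAt).clm_apply
      (differentiableAt_const _)
  refine ⟨N, inter_subset_left, hN, h0N, γ, by simp [γ, ha0], fun v hv =>
    ⟨hγd v hv, hγ v hv, fun u ε hε => ?_⟩⟩
  -- Differentiating the equation for `γ` shows that its differential solves the linear equation
  -- imposed on `ε`, whose solution is unique.
  have h1 := (hγd v hv).hasFDerivAt.sub ((hT v hv.1).clm_apply (hγd v hv).hasFDerivAt)
  have h2 : HasFDerivAt (fun v => γ v - Φ (a v) (γ v)) (0 : V →L[𝕜] Y) v :=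
    (hasFDerivAt_const x v).congr_of_eventuallyEq
      (Filter.eventually_of_mem (hN.mem_nhds hv) hγ)
  have h3 : fderiv 𝕜 γ v u - (Φ (a v) (fderiv 𝕜 γ v u) + Φ (a' v u) (γ v)) = 0 :=
    congrArg (fun t : V →L[𝕜] Y => t u) (h1.unique h2)
  refine sub_eq_zero.1 (hinj v hv _ ?_)
  rw [map_sub]
  nth_rewrite 1 [sub_eq_zero.1 h3, ← hε]
  abel

set_option maxHeartbeats 1000000 in
/-- Local solutions of the total linear system `D_u ξ = A(u) ξ`, for a field `A` of operator-valued
forms with commuting values whose differential is symmetric. -/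
theorem exists_local_solution [CompleteSpace X] {A : V → V →L[𝕜] X →L[𝕜] X} {U : Set V}
    (hU : IsOpen U) (hA : ContDiffOn 𝕜 1 A U)
    (hsymm : ∀ y ∈ U, ∀ u v, fderiv 𝕜 A y u v = fderiv 𝕜 A y v u)
    (hcomm : ∀ y ∈ U, ∀ u v x, A y u (A y v x) = A y v (A y u x))
    {y₀ : V} (hy₀ : y₀ ∈ U) (x₀ : X) :
    ∃ W ⊆ U, IsOpen W ∧ y₀ ∈ W ∧ ∃ ξ : V → X, ξ y₀ = x₀ ∧
      ∀ y ∈ W, HasFDerivAt ξ ((A y).flip (ξ y)) y := by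
  let _ : NormedSpace ℝ V := NormedSpace.restrictScalars ℝ 𝕜 V
  let _ : NormedSpace ℝ X := NormedSpace.restrictScalars ℝ 𝕜 X
  have : IsScalarTower ℝ 𝕜 V := RestrictScalars.isScalarTower ℝ 𝕜 V
  have : IsScalarTower ℝ 𝕜 X := RestrictScalars.isScalarTower ℝ 𝕜 X
  obtain ⟨ρ, hρ, hball⟩ := Metric.isOpen_iff.1 hU y₀ hy₀
  have hmem : ∀ (s : I), ∀ v ∈ Metric.ball (0 : V) ρ, y₀ + (s : ℝ) • v ∈ U := fun s v hv => by
    apply hball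
    rw [mem_ball_iff_norm, add_sub_cancel_left, norm_smul, Real.norm_of_nonneg s.2.1]
    rw [mem_ball_zero_iff] at hv
    exact (mul_le_of_le_one_left (norm_nonneg v) s.2.2).trans_lt hv
  have hAd : ∀ y ∈ U, HasFDerivAt A (fderiv 𝕜 A y) y := fun y hy =>
    ((hA.differentiableOn one_ne_zero).differentiableAt (hU.mem_nhds hy)).hasFDerivAt
  have hA'c : ContinuousOn (fderiv 𝕜 A) U := hA.continuousOn_fderiv_of_isOpen hU le_rfl
  have hAc : ContinuousOn A U := hA.continuousOn
  -- the coefficients along the ray in the direction `v`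
  let f : I → V → X →L[𝕜] X := fun s v => A (y₀ + (s : ℝ) • v) v
  let f' : I → V → V →L[𝕜] X →L[𝕜] X := fun s v =>
    (s : ℝ) • ((fderiv 𝕜 A (y₀ + (s : ℝ) • v)).flip v) + A (y₀ + (s : ℝ) • v)
  have hf : ∀ s, ∀ v ∈ Metric.ball (0 : V) ρ, HasFDerivAt (f s) (f' s v) v := fun s v hv => by
    have h1 : HasFDerivAt (fun v : V => y₀ + (s : ℝ) • v)
        ((s : ℝ) • ContinuousLinearMap.id 𝕜 V) v :=
      ((hasFDerivAt_id v).const_smul (s : ℝ)).const_add y₀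
    have h2 : HasFDerivAt (fun v : V => A (y₀ + (s : ℝ) • v)) _ v :=
      HasFDerivAt.comp (g := A) v (hAd _ (hmem s v hv)) h1
    have h2 := h2.clm_apply (hasFDerivAt_id v)
    refine h2.congr_fderiv ?_
    ext h x
    simp [f', add_comm]
  have hfcont : ∀ z : I × V, z.2 ∈ Metric.ball (0 : V) ρ →
      ContinuousAt (Function.uncurry f') z := fun z hz => by
    have h1 : ContinuousAt (fun z : I × V => y₀ + (z.1 : ℝ) • z.2) z := by fun_prop
    have h2 : ContinuousAt (fun z : I × V => A (y₀ + (z.1 : ℝ) • z.2)) z :=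
      ContinuousAt.comp (f := fun z : I × V => y₀ + (z.1 : ℝ) • z.2)
        (hAc.continuousAt (hU.mem_nhds (hmem _ _ hz))) h1
    have h3 : ContinuousAt (fun z : I × V => fderiv 𝕜 A (y₀ + (z.1 : ℝ) • z.2)) z :=
      ContinuousAt.comp (f := fun z : I × V => y₀ + (z.1 : ℝ) • z.2)
        (hA'c.continuousAt (hU.mem_nhds (hmem _ _ hz))) h1
    have h4 : ContinuousAt
        (fun z : I × V => (fderiv 𝕜 A (y₀ + (z.1 : ℝ) • z.2)).flip z.2) z := by
      have := (ContinuousLinearMap.flipₗᵢ 𝕜 V V (X →L[𝕜] X)).continuous.continuousAt.comp h3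
      exact this.clm_apply continuousAt_snd
    have h5 : ContinuousAt (fun z : I × V => (z.1 : ℝ)) z := by fun_prop
    exact (h5.smul h4).add h2
  have hfc : ∀ v ∈ Metric.ball (0 : V) ρ, Continuous fun s => f s v := fun v hv => by
    have h1 : Continuous fun s : I => A (y₀ + (s : ℝ) • v) :=
      hAc.comp_continuous (by fun_prop) fun s => hmem s v hv
    exact h1.clm_apply continuous_const
  have hf'c : ∀ v ∈ Metric.ball (0 : V) ρ, Continuous fun s => f' s v := fun v hv =>
    continuous_iff_continuousAt.2 fun s =>
      ContinuousAt.comp (g := Function.uncurry f') (f := fun s : I => (s, v)) (x := s)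
        (hfcont (s, v) hv) (by fun_prop)
  -- The default `0` applies only where `s ↦ f s v` is not continuous, which does not happen for `v`
  -- in the ball.
  let a : V → (I →ᵇ (X →L[𝕜] X)) := fun v => mkOfCompact (ContinuousMap.mkD (fun s => f s v) 0)
  have ha_apply : ∀ v ∈ Metric.ball (0 : V) ρ, ∀ s, a v s = f s v := fun v hv s =>
    ContinuousMap.mkD_apply_of_continuous (hfc v hv)
  have h0ball : (0 : V) ∈ Metric.ball (0 : V) ρ := Metric.mem_ball_self hρ
  have ha0 : a 0 = 0 := by
    ext1 s
    rw [ha_apply 0 h0ball s]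
    simp [f]
  let a' : V → V →L[𝕜] (I →ᵇ (X →L[𝕜] X)) := fun v =>
    evalFamily (mkOfCompact (ContinuousMap.mkD (fun s => f' s v) 0))
  have ha'_apply : ∀ v ∈ Metric.ball (0 : V) ρ, ∀ u s, a' v u s = f' s v u := fun v hv u s => by
    simp only [a', evalFamily_apply, mkOfCompact_apply]
    rw [ContinuousMap.mkD_apply_of_continuous (hf'c v hv)]
  have ha : ∀ v ∈ Metric.ball (0 : V) ρ, HasFDerivAt a (a' v) v := fun v hv =>
    hasFDerivAt_mkD (Metric.isOpen_ball.mem_nhds hv) hf hfc (fun s => hfcont (s, v) hv) _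
      fun s => ContinuousMap.mkD_apply_of_continuous (hf'c v hv)
  let Φ : (I →ᵇ (X →L[𝕜] X)) →L[𝕜] (I →ᵇ X) →L[𝕜] (I →ᵇ X) :=
    (ContinuousLinearMap.postcomp (I →ᵇ X) (volterra 𝕜)).comp applyFamily
  have hΦ : ∀ c γ, Φ c γ = volterra 𝕜 (applyFamily (𝕜 := 𝕜) c γ) := fun c γ => rfl
  -- The path `γ v` is the solution on the ray `s ↦ y₀ + s v`, starting at `x₀`; it depends
  -- differentiably on `v` because the resolvent does.
  obtain ⟨N, hNB, hN, h0N, γ, hγ0, hγ⟩ := @exists_resolvent_family 𝕜 V _ _ _ (I →ᵇ X)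
    (I →ᵇ (X →L[𝕜] X)) _ _ _ _ _ Φ a a' _ Metric.isOpen_ball h0ball ha ha0
    (BoundedContinuousFunction.const I x₀)
  have hkey : ∀ v ∈ N, ∀ u, fderiv 𝕜 γ v u 1 = A (y₀ + v) u (γ v 1) := fun v hv u => by
    -- An extension of `γ v` to the real line, so that two-sided derivatives exist also at the
    -- endpoints of the interval.
    let Γ : ℝ → X := fun t =>
      x₀ + ∫ s in (0:ℝ)..t, IccExtend zero_le_one (applyFamily (𝕜 := 𝕜) (a v) (γ v)) s
    have hΓ : ∀ s : I, Γ s = γ v s := fun s => by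
      have h := congrArg (fun c : I →ᵇ X => c s) (hγ v hv).2.1
      simp only [BoundedContinuousFunction.sub_apply, BoundedContinuousFunction.const_apply] at h
      exact (sub_eq_iff_eq_add.1 h).symm
    have hΓ' : ∀ s : I, HasDerivAt Γ (A (y₀ + (s : ℝ) • v) v (γ v s)) s := fun s => by
      have h := (hasDerivAt_volterra (applyFamily (𝕜 := 𝕜) (a v) (γ v)) s).const_add x₀
      rwa [applyFamily_apply, ha_apply v (hNB hv)] at h
    -- If `γ v s = ξ (y₀ + s v)` with `D_u ξ = A(u) ξ`, the chain rule forces this value of the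
    -- derivative of `γ` in the direction `u`.
    let φ : ℝ → X := fun t => t • A (y₀ + t • v) u (Γ t)
    have hφ : ∀ s : I, HasDerivAt φ ((s : ℝ) • (fderiv 𝕜 A (y₀ + (s : ℝ) • v) v u (γ v s)
        + A (y₀ + (s : ℝ) • v) u (A (y₀ + (s : ℝ) • v) v (γ v s)))
        + A (y₀ + (s : ℝ) • v) u (γ v s)) s := fun s => by
      have h1 : HasDerivAt (fun t : ℝ => y₀ + t • v) v s := by
        simpa using ((hasDerivAt_id (s : ℝ)).smul_const v).const_add y₀
      have hfst : HasFDerivAt (Prod.fst : V × X → V) (ContinuousLinearMap.fst 𝕜 V X)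
        (y₀ + (s : ℝ) • v, γ v s) := hasFDerivAt_fst
      have hsnd : HasFDerivAt (Prod.snd : V × X → X) (ContinuousLinearMap.snd 𝕜 V X)
        (y₀ + (s : ℝ) • v, γ v s) := hasFDerivAt_snd
      have h2 : HasFDerivAt (fun z : V × X => A z.1) _ (y₀ + (s : ℝ) • v, γ v s) :=
        HasFDerivAt.comp (g := A) (f := Prod.fst) (y₀ + (s : ℝ) • v, γ v s)
          (hAd _ (hmem s v (hNB hv))) hfst
      have h2 := (h2.clm_apply (hasFDerivAt_const u _)).clm_apply hsnd
      have h3 : HasDerivAt (fun t : ℝ => (y₀ + t • v, Γ t))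
          (v, A (y₀ + (s : ℝ) • v) v (γ v s)) s := h1.prodMk (hΓ' s)
      have h4 : HasDerivAt (fun t : ℝ => A (y₀ + t • v) u (Γ t))
          (fderiv 𝕜 A (y₀ + (s : ℝ) • v) v u (γ v s)
            + A (y₀ + (s : ℝ) • v) u (A (y₀ + (s : ℝ) • v) v (γ v s))) s := by
        rw [← hΓ s] at h2
        have h5 := HasFDerivAt.comp_hasDerivAt (s : ℝ) (h2.restrictScalars ℝ) h3
        refine h5.congr_deriv ?_
        simp [hΓ s, add_comm]
      have h6 := (hasDerivAt_id (s : ℝ)).smul h4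
      rw [hΓ s, one_smul] at h6
      exact h6
    let ε : I →ᵇ X := mkOfCompact ⟨fun s => φ s, continuous_iff_continuousAt.2 fun s =>
      ContinuousAt.comp (g := φ) (hφ s).continuousAt continuous_subtype_val.continuousAt⟩
    have hε : Φ (a v) ε + Φ (a' v u) (γ v) = ε := by
      rw [hΦ, hΦ, ← map_add]
      ext1 t
      rw [volterra_eq_sub _ φ (fun s => ?_) t]
      · simp [ε, φ]
      · refine (hφ s).congr_deriv ?_
        have hs := hmem s v (hNB hv)
        simp only [BoundedContinuousFunction.add_apply, applyFamily_apply,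
          ha_apply v (hNB hv), ha'_apply v (hNB hv)]
        simp only [ε, φ, f, f', mkOfCompact_apply, ContinuousMap.coe_mk, hΓ,
          _root_.add_apply, _root_.smul_apply,
          ContinuousLinearMap.flip_apply]
        -- Both integrability conditions enter here: symmetry of the differential of `A` and
        -- commutation of its values.
        rw [hsymm _ hs v u, hcomm _ hs u v, smul_add,
          LinearMapClass.map_smul_of_tower (A (y₀ + (s : ℝ) • v) v)]
        abel
    have h1 := congrArg (fun c : I →ᵇ X => c 1) ((hγ v hv).2.2 u ε hε)
    have h2 : ε 1 = A (y₀ + v) u (γ v 1) := by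
      have := hΓ 1
      simp only [Icc.coe_one] at this
      simp [ε, φ, this]
    exact h1.trans h2
  refine ⟨(fun y => y - y₀) ⁻¹' N, fun y hy => ?_, hN.preimage (by fun_prop), by simpa using h0N,
    fun y => γ (y - y₀) 1, ?_, fun y hy => ?_⟩
  · simpa using hmem 1 _ (hNB hy)
  · simp [hγ0]
  · have h1 := (hγ _ hy).1.hasFDerivAt.comp y ((hasFDerivAt_id y).sub_const y₀)
    have h2 := (BoundedContinuousFunction.evalCLM 𝕜 (1 : I)).hasFDerivAt.comp y h1
    refine h2.congr_fderiv ?_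
    ext u
    simpa using hkey _ hy u

end Existence

theorem natCast_le_infty (n : ℕ) : (n : ℕ∞ω) ≤ ∞ := by
  exact_mod_cast (le_top : (n : ℕ∞) ≤ ⊤)

/-! ### Algebra of division by an invertible element. -/

section QuotientAlgebra

variable {𝕜 A : Type*} [NontriviallyNormedField 𝕜] [AddCommGroup A] [Module 𝕜 A]
  [TopologicalSpace A] [IsTopologicalAddGroup A] [ContinuousConstSMul 𝕜 A]
  {mul : A →L[𝕜] A →L[𝕜] A} {form : A →L[𝕜] A →L[𝕜] 𝕜} {one a b : A}

theorem IsFrobeniusAlgebra.divBy_apply (h : IsFrobeniusAlgebra mul form one) (hab : mul a b = one)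
    (v : A) : divBy mul a v = mul b v :=
  divBy_eq_mul h.mul_comm h.mul_assoc h.one_mul hab v

theorem IsFrobeniusAlgebra.quotMul_eq (h : IsFrobeniusAlgebra mul form one) (hab : mul a b = one)
    (u v : A) : quotMul mul a u v = mul b (mul u v) :=
  h.divBy_apply hab _

theorem IsFrobeniusAlgebra.quotForm_eq (h : IsFrobeniusAlgebra mul form one) (hab : mul a b = one)
    (u v : A) : quotForm mul form a u v = form u (mul b v) := by
  rw [quotForm_apply, h.divBy_apply hab]

theorem IsFrobeniusAlgebra.mul_left_comm (h : IsFrobeniusAlgebra mul form one) (x y z : A) :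
    mul x (mul y z) = mul y (mul x z) := by
  rw [← h.mul_assoc, h.mul_comm x y, h.mul_assoc]

theorem IsFrobeniusAlgebra.mul_mul_cancel (h : IsFrobeniusAlgebra mul form one)
    (hab : mul a b = one) (x : A) : mul a (mul b x) = x := by
  rw [← h.mul_assoc, hab, h.one_mul]

/-- Division of the product and of the form by an invertible element `a` gives a Frobenius algebra
with unity `a`. -/
theorem IsFrobeniusAlgebra.quot (h : IsFrobeniusAlgebra mul form one) (hab : mul a b = one) :
    IsFrobeniusAlgebra (quotMul mul a) (quotForm mul form a) a where
  mul_comm x y := by rw [h.quotMul_eq hab, h.quotMul_eq hab, h.mul_comm x]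
  mul_assoc x y z := by
    simp only [h.quotMul_eq hab, h.mul_assoc]
    rw [h.mul_left_comm x b]
  one_mul x := by rw [h.quotMul_eq hab, h.mul_left_comm, h.mul_mul_cancel hab]
  form_symm x y := by
    rw [h.quotForm_eq hab, h.quotForm_eq hab, ← h.form_invariant, h.form_symm, h.mul_comm x]
  form_nondegenerate x hx := h.form_nondegenerate x fun y => by
    have := hx (mul a y)
    rwa [h.quotForm_eq hab, h.mul_left_comm, h.mul_mul_cancel hab] at this
  form_invariant x y z := by
    simp only [h.quotForm_eq hab, h.quotMul_eq hab]
    rw [h.mul_left_comm b x y, h.form_invariant, h.mul_assoc, h.mul_left_comm b y,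
      h.mul_left_comm b y, h.mul_left_comm b y]

/-- The old unity is invertible in the new algebra, with inverse the old square of `a`: one factor
`a` is cancelled by the division and the other is the new unity. -/
theorem IsFrobeniusAlgebra.quotMul_one_mul_self (h : IsFrobeniusAlgebra mul form one)
    (hab : mul a b = one) : quotMul mul a one (mul a a) = a := by
  rw [h.quotMul_eq hab, h.one_mul, h.mul_left_comm, h.mul_mul_cancel hab]

/-- Dividing by the old unity recovers the original product. -/
theorem IsFrobeniusAlgebra.quotMul_quotMul (h : IsFrobeniusAlgebra mul form one)
    (hab : mul a b = one) : quotMul (quotMul mul a) one = mul := by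
  ext u v
  rw [(h.quot hab).quotMul_eq (h.quotMul_one_mul_self hab), h.quotMul_eq hab, h.quotMul_eq hab,
    h.mul_assoc, h.mul_left_comm b, h.mul_mul_cancel hab, h.mul_left_comm b, h.mul_left_comm a,
    h.mul_mul_cancel hab]

/-- Dividing by the old unity recovers the original form. -/
theorem IsFrobeniusAlgebra.quotForm_quotForm (h : IsFrobeniusAlgebra mul form one)
    (hab : mul a b = one) : quotForm (quotMul mul a) (quotForm mul form a) one = form := by
  ext u v
  rw [(h.quot hab).quotForm_eq (h.quotMul_one_mul_self hab), h.quotForm_eq hab, h.quotMul_eq hab,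
    h.mul_assoc, h.mul_left_comm b a, h.mul_mul_cancel hab, h.mul_left_comm b a, h.mul_mul_cancel hab]

end QuotientAlgebra

/-! ### Leibniz rules. -/

section Derivatives

variable {𝕜 V W : Type*} [NontriviallyNormedField 𝕜] [NormedAddCommGroup V] [NormedSpace 𝕜 V]
  [NormedAddCommGroup W] [NormedSpace 𝕜 W]

/-- Leibniz rule for a varying bilinear map applied to two vector fields. -/
theorem fderiv_bilin_apply {T : V → V →L[𝕜] V →L[𝕜] W} {a b : V → V} {y : V}
    (hT : DifferentiableAt 𝕜 T y) (ha : DifferentiableAt 𝕜 a y) (hb : DifferentiableAt 𝕜 b y)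
    (u : V) :
    fderiv 𝕜 (fun z => T z (a z) (b z)) y u =
      fderiv 𝕜 T y u (a y) (b y) + T y (fderiv 𝕜 a y u) (b y) + T y (a y) (fderiv 𝕜 b y u) := by
  rw [fderiv_clm_apply (hT.clm_apply ha) hb, fderiv_clm_apply hT ha]
  simp only [_root_.add_apply, ContinuousLinearMap.comp_apply, ContinuousLinearMap.flip_apply]
  abel

theorem fderiv_bilin_const_apply {T : V → V →L[𝕜] V →L[𝕜] W} {y : V}
    (hT : DifferentiableAt 𝕜 T y) (u v w : V) :
    fderiv 𝕜 (fun z => T z v w) y u = fderiv 𝕜 T y u v w := by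
  rw [fderiv_bilin_apply hT (differentiableAt_const v) (differentiableAt_const w)]
  simp

theorem fderiv_apply_const {T : V → V →L[𝕜] W} {y : V}
    (hT : DifferentiableAt 𝕜 T y) (u v : V) :
    fderiv 𝕜 (fun z => T z v) y u = fderiv 𝕜 T y u v := by
  rw [fderiv_clm_apply hT (differentiableAt_const v)]
  simp

end Derivatives

/-! ### Existence of twisted periods and the effect of the shift on them. -/

section TwistedPeriods

open Set Filter Topology

variable {𝕜 V : Type*} [RCLike 𝕜] [NormedAddCommGroup V] [NormedSpace 𝕜 V]

theorem IsFrobeniusAlgebra.injective {mul : V →L[𝕜] V →L[𝕜] V} {form : V →L[𝕜] V →L[𝕜] 𝕜} {one : V}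
    (h : IsFrobeniusAlgebra mul form one) {x y : V} (hxy : ∀ z, form x z = form y z) : x = y := by
  refine sub_eq_zero.1 (h.form_nondegenerate _ fun z => ?_)
  rw [map_sub, _root_.sub_apply, hxy z, sub_self]

/-- A product whose structure constants are third derivatives has a symmetric differential. -/
theorem fderiv_mul_symm {r : ℕ∞ω} (hr : ∞ ≤ r) {U : Set V} (hU : IsOpen U)
    {G : V →L[𝕜] V →L[𝕜] 𝕜} {star : V → V →L[𝕜] V →L[𝕜] V} {E : V → V}
    (halg : ∀ y ∈ U, IsFrobeniusAlgebra (star y) G (E y))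
    (hstar : ∀ y ∈ U, DifferentiableAt 𝕜 star y) {F : V → 𝕜} (hF : ContDiffOn 𝕜 r F U)
    (hFG : ∀ y ∈ U, ∀ u v w, G (star y u v) w = iteratedFDeriv 𝕜 3 F y ![u, v, w])
    {y : V} (hy : y ∈ U) (u v : V) : fderiv 𝕜 star y u v = fderiv 𝕜 star y v u := by
  ext w
  refine (halg y hy).injective fun z => ?_
  -- With the slots `w, z` frozen, the second differential of `k` is `G` of the differential of the
  -- product, so the claim is Schwarz's theorem for `k`.
  let k : V → 𝕜 := fun x => iteratedFDeriv 𝕜 2 F x ![w, z]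
  have hk : ContDiffAt 𝕜 2 k y := by
    have h1 : ContDiffAt 𝕜 ((4 : ℕ) : ℕ∞ω) F y := ((hF y hy).contDiffAt (hU.mem_nhds hy)).of_le
      ((natCast_le_infty _).trans hr)
    have h2 : ContDiffAt 𝕜 2 (iteratedFDeriv 𝕜 2 F) y := h1.iteratedFDeriv_right (by norm_num)
    exact (ContinuousMultilinearMap.apply 𝕜 (fun _ : Fin 2 => V) 𝕜 ![w, z]).contDiff.contDiffAt.comp
      y h2
  have hkd : ∀ x ∈ U, ∀ a, fderiv 𝕜 k x a = G (star x a w) z := fun x hx a => by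
    rw [hFG x hx, iteratedFDeriv_succ_apply_left]
    have h1 : ContDiffAt 𝕜 ((3 : ℕ) : ℕ∞ω) F x := ((hF x hx).contDiffAt (hU.mem_nhds hx)).of_le
      ((natCast_le_infty _).trans hr)
    have h2 : DifferentiableAt 𝕜 (iteratedFDeriv 𝕜 2 F) x :=
      (h1.iteratedFDeriv_right (m := 1) (by norm_num)).differentiableAt one_ne_zero
    exact congrArg (fun t : V →L[𝕜] 𝕜 => t a)
      ((ContinuousMultilinearMap.apply 𝕜 (fun _ : Fin 2 => V) 𝕜 ![w, z]).hasFDerivAt.comp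
        x h2.hasFDerivAt).fderiv
  have hkd' : DifferentiableAt 𝕜 (fderiv 𝕜 k) y :=
    (hk.fderiv_right (m := 1) le_rfl).differentiableAt one_ne_zero
  have h2 : ∀ a b, fderiv 𝕜 (fderiv 𝕜 k) y a b = G (fderiv 𝕜 star y a b w) z := fun a b => by
    rw [← fderiv_apply_const hkd']
    have h3 : (fun x => fderiv 𝕜 k x b) =ᶠ[𝓝 y] fun x => G.flip z (star x b w) :=
      Filter.eventually_of_mem (hU.mem_nhds hy) fun x hx => hkd x hx b
    rw [h3.fderiv_eq, ← fderiv_bilin_const_apply (hstar y hy)]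
    have h4 : DifferentiableAt 𝕜 (fun x => star x b w) y :=
      ((hstar y hy).clm_apply (differentiableAt_const b)).clm_apply (differentiableAt_const w)
    exact congrArg (fun t : V →L[𝕜] 𝕜 => t a) ((G.flip z).hasFDerivAt.comp y h4.hasFDerivAt).fderiv
  rw [← h2, ← h2]
  exact hk.isSymmSndFDerivAt (by simp) u v

/-- Twisted periods with a prescribed differential at a point. -/
theorem exists_isTwistedPeriod [CompleteSpace V] {κ ν : 𝕜} (hν : ν + κ ≠ 0) {U : Set V}
    (hU : IsOpen U) {G : V →L[𝕜] V →L[𝕜] 𝕜} {star : V → V →L[𝕜] V →L[𝕜] V}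
    (halg : ∀ y ∈ U, IsFrobeniusAlgebra (star y) G (κ • y)) (hstar : ContDiffOn 𝕜 1 star U)
    (hsymm : ∀ y ∈ U, ∀ u v, fderiv 𝕜 star y u v = fderiv 𝕜 star y v u)
    {y₀ : V} (hy₀ : y₀ ∈ U) (ξ₀ : V) :
    ∃ W ⊆ U, IsOpen W ∧ y₀ ∈ W ∧ ∃ p : V → 𝕜, IsTwistedPeriod star ν W p ∧
      fderiv 𝕜 p y₀ = G ξ₀ := by
  have hd : ∀ y ∈ U, DifferentiableAt 𝕜 star y := fun y hy =>
    (hstar.differentiableOn one_ne_zero).differentiableAt (hU.mem_nhds hy)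
  obtain ⟨W, hWU, hW, hyW, ξ, hξ₀, hξ⟩ := exists_local_solution (A := fun y => ν • star y) hU
    (hstar.const_smul ν) (fun y hy u v => by
      have h1 : DifferentiableAt 𝕜 (fun y => ν • star y) y :=
        ((hstar.const_smul ν).differentiableOn one_ne_zero).differentiableAt (hU.mem_nhds hy)
      have h2 : ∀ a b c, fderiv 𝕜 (fun y => ν • star y) y a b c = ν • fderiv 𝕜 star y a b c :=
        fun a b c => by
        have h3 : DifferentiableAt 𝕜 (fun y => star y b c) y :=
          ((hd y hy).clm_apply (differentiableAt_const b)).clm_apply (differentiableAt_const c)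
        rw [← fderiv_bilin_const_apply h1, ← fderiv_bilin_const_apply (hd y hy)]
        simp only [_root_.smul_apply, fderiv_fun_const_smul h3]
      ext x
      rw [h2, h2, hsymm y hy u v]) (fun y hy u v x => by
      simp [(halg y hy).mul_left_comm u v]) hy₀ ξ₀
  -- The candidate is `(ξ, E) / (ν + κ)`: since `E = κ y` is the unity, the derivative of `(ξ, E)`
  -- along `u` is `ν (u * ξ, E) + κ (ξ, u) = (ν + κ) (ξ, u)`. No Poincaré lemma is required.
  let p : V → 𝕜 := fun y => (ν + κ)⁻¹ * G (ξ y) (κ • y)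
  have hp : ∀ y ∈ W, HasFDerivAt p (G (ξ y)) y := fun y hy => by
    have hA := halg y (hWU hy)
    have h1 : HasFDerivAt (fun y => G (ξ y)) _ y := G.hasFDerivAt.comp y (hξ y hy)
    have h2 := (h1.clm_apply ((hasFDerivAt_id y).const_smul κ)).const_mul (ν + κ)⁻¹
    refine h2.congr_fderiv ?_
    ext u
    have h3 : G (star y u (ξ y)) (κ • y) = G (ξ y) u := by
      rw [hA.form_invariant, hA.mul_comm, hA.one_mul, hA.form_symm]
    rw [map_smul, smul_eq_mul] at h3
    simp
    field_simp
    linear_combination ν * h3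
  have hξc : ContDiffOn 𝕜 1 ξ W := by
    have hξ0 : ContinuousOn ξ W := fun y hy => (hξ y hy).continuousAt.continuousWithinAt
    rw [show (1 : ℕ∞ω) = 0 + 1 by norm_num, contDiffOn_succ_iff_fderiv_of_isOpen hW, contDiffOn_zero]
    refine ⟨fun y hy => (hξ y hy).differentiableAt.differentiableWithinAt, by simp, ?_⟩
    have h1 : ContinuousOn (fun y => (ν • star y).flip) W :=
      (ContinuousLinearMap.flipₗᵢ 𝕜 V V V).continuous.comp_continuousOn
        ((hstar.continuousOn.mono hWU).const_smul ν)
    exact (h1.clm_apply hξ0).congr fun y hy => (hξ y hy).fderiv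
  refine ⟨W, hWU, hW, hyW, p, ⟨?_, fun y hy u v => ?_⟩, by rw [(hp y₀ hyW).fderiv, hξ₀]⟩
  · rw [show (2 : ℕ∞ω) = 1 + 1 by norm_num, contDiffOn_succ_iff_fderiv_of_isOpen hW]
    refine ⟨fun y hy => (hp y hy).differentiableAt.differentiableWithinAt, by simp, ?_⟩
    exact (G.contDiff.comp_contDiffOn hξc).congr fun y hy => (hp y hy).fderiv
  · have hA := halg y (hWU hy)
    have h1 : (fun z => fderiv 𝕜 p z v) =ᶠ[𝓝 y] fun z => G.flip v (ξ z) :=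
      Filter.eventually_of_mem (hW.mem_nhds hy) fun z hz => by simp [(hp z hz).fderiv]
    have h2 : HasFDerivAt (fun z => G.flip v (ξ z)) _ y := (G.flip v).hasFDerivAt.comp y (hξ y hy)
    rw [h1.fderiv_eq, h2.fderiv, (hp y hy).fderiv]
    simp [hA.mul_comm u (ξ y), hA.form_invariant]

/-- For `ν = 0` the equation only asks for a vanishing second derivative, so every covector is the
differential of a period without solving anything. -/
theorem isTwistedPeriod_zero (star : V → V →L[𝕜] V →L[𝕜] V) (W : Set V) (α : V →L[𝕜] 𝕜) :
    IsTwistedPeriod star 0 W α :=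
  ⟨α.contDiff.contDiffOn, fun y _ u v => by simp⟩

variable {star : V → V →L[𝕜] V →L[𝕜] V} {e : V → V} {ν : 𝕜} {W : Set V} {p : V → 𝕜}

/-- In the product rule for `dp(e)` the period equation turns the second derivative of `p` into a
first one, so only `dp` remains. -/
theorem IsTwistedPeriod.fderiv_along (hW : IsOpen W) (hp : IsTwistedPeriod star ν W p) {y : V}
    (hy : y ∈ W) (he : DifferentiableAt 𝕜 e y) (v : V) :
    fderiv 𝕜 (along e p) y v = fderiv 𝕜 p y (fderiv 𝕜 e y v + ν • star y v (e y)) := by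
  have h1 : DifferentiableAt 𝕜 (fderiv 𝕜 p) y :=
    (((hp.1 y hy).contDiffAt (hW.mem_nhds hy)).fderiv_right (m := 1) (by norm_num)).differentiableAt
      one_ne_zero
  unfold along
  rw [fderiv_clm_apply h1 he]
  have h2 := hp.2 y hy v (e y)
  rw [fderiv_apply_const h1] at h2
  simp [h2]

/-- If the shift takes a twisted period to a twisted period, then its differential satisfies the
relation obtained by differentiating twice. -/
theorem IsTwistedPeriod.shift_relation (hW : IsOpen W) (hp : IsTwistedPeriod star ν W p)
    (hp' : IsTwistedPeriod star (ν - 1) W (along e p)) {y : V} (hy : y ∈ W)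
    (hstar : ∀ z ∈ W, DifferentiableAt 𝕜 star z) (he : ContDiffOn 𝕜 2 e W) (u v : V) :
    fderiv 𝕜 p y (ν • star y u (fderiv 𝕜 e y v + ν • star y v (e y))
      + fderiv 𝕜 (fderiv 𝕜 e) y u v
      + ν • (fderiv 𝕜 star y u v (e y) + star y v (fderiv 𝕜 e y u))
      - (ν - 1) • (fderiv 𝕜 e y (star y u v) + ν • star y (star y u v) (e y))) = 0 := by
  have hed : ∀ z ∈ W, DifferentiableAt 𝕜 e z := fun z hz =>
    (he.differentiableOn two_ne_zero).differentiableAt (hW.mem_nhds hz)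
  have hed2 : DifferentiableAt 𝕜 (fderiv 𝕜 e) y :=
    (((he y hy).contDiffAt (hW.mem_nhds hy)).fderiv_right (m := 1) (by norm_num)).differentiableAt
      one_ne_zero
  have h1 : DifferentiableAt 𝕜 (fderiv 𝕜 p) y :=
    (((hp.1 y hy).contDiffAt (hW.mem_nhds hy)).fderiv_right (m := 1) (by norm_num)).differentiableAt
      one_ne_zero
  have h2 := hp'.2 y hy u v
  have h3 : (fun z => fderiv 𝕜 (along e p) z v) =ᶠ[𝓝 y]
      fun z => fderiv 𝕜 p z (fderiv 𝕜 e z v + ν • star z v (e z)) :=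
    Filter.eventually_of_mem (hW.mem_nhds hy) fun z hz => hp.fderiv_along hW hz (hed z hz) v
  have h4 : DifferentiableAt 𝕜 (fun z => fderiv 𝕜 e z v) y :=
    hed2.clm_apply (differentiableAt_const v)
  have h5 : DifferentiableAt 𝕜 (fun z => star z v (e z)) y :=
    ((hstar y hy).clm_apply (differentiableAt_const v)).clm_apply (hed y hy)
  rw [h3.fderiv_eq, fderiv_clm_apply h1 (h4.fun_add (h5.fun_const_smul ν)), hp.fderiv_along hW hy (hed y hy),
    fderiv_fun_add h4 (h5.fun_const_smul ν), fderiv_fun_const_smul h5] at h2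
  simp only [_root_.add_apply, _root_.smul_apply, ContinuousLinearMap.comp_apply,
    ContinuousLinearMap.flip_apply, fderiv_apply_const hed2] at h2
  rw [fderiv_bilin_apply (hstar y hy) (differentiableAt_const v) (hed y hy),
    ← fderiv_apply_const h1, hp.2 y hy u] at h2
  simp only [fderiv_fun_const, Pi.zero_apply, _root_.zero_apply, map_zero, add_zero,
    smul_add] at h2
  simp only [map_sub, map_add, map_smul, smul_eq_mul, smul_add] at h2 ⊢
  linear_combination h2

end TwistedPeriods

/-! ### From the action on periods to pointwise identities. -/

section ShiftIdentities

open Set Filter Topology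

variable {𝕜 V : Type*} [RCLike 𝕜] [NormedAddCommGroup V] [NormedSpace 𝕜 V]
  [FiniteDimensional 𝕜 V]

/-- A nondegenerate bilinear form identifies a finite-dimensional space with its dual. -/
theorem isInvertible_of_nondegenerate {B : V →L[𝕜] V →L[𝕜] 𝕜}
    (hB : ∀ x, (∀ y, B x y = 0) → x = 0) : B.IsInvertible := by
  have hinj : Function.Injective (B : V →ₗ[𝕜] V →L[𝕜] 𝕜) := by
    rw [← LinearMap.ker_eq_bot, LinearMap.ker_eq_bot']
    exact fun x hx => hB x fun y => congrArg (fun t : V →L[𝕜] 𝕜 => t y) hx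
  have hrank : Module.finrank 𝕜 V = Module.finrank 𝕜 (V →L[𝕜] 𝕜) := by
    rw [← (LinearMap.toContinuousLinearMap (𝕜 := 𝕜) (E := V) (F' := 𝕜)).finrank_eq]
    exact (Subspace.dual_finrank_eq (K := 𝕜) (V := V)).symm
  have : FiniteDimensional 𝕜 (V →L[𝕜] 𝕜) :=
    (LinearMap.toContinuousLinearMap (𝕜 := 𝕜) (E := V) (F' := 𝕜)).finiteDimensional
  refine ⟨(LinearEquiv.ofInjectiveOfFinrankEq (B : V →ₗ[𝕜] V →L[𝕜] 𝕜) hinj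
    hrank).toContinuousLinearEquiv, ?_⟩
  ext x y
  rfl

/-- The relations between the product, the metric and the shift field that follow from the action
of the shift on twisted periods. -/
structure ShiftIdentities (star : V → V →L[𝕜] V →L[𝕜] V) (G : V →L[𝕜] V →L[𝕜] 𝕜) (e : V → V)
    (y : V) : Prop where
  symm : ∀ u v, fderiv 𝕜 star y u v = fderiv 𝕜 star y v u
  second : ∀ u v, fderiv 𝕜 (fderiv 𝕜 e) y u v = - fderiv 𝕜 e y (star y u v)
  leibniz : ∀ u v, star y u (fderiv 𝕜 e y v) + fderiv 𝕜 star y u v (e y)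
    + star y v (fderiv 𝕜 e y u) = fderiv 𝕜 e y (star y u v) - star y (star y u v) (e y)
  adjoint : ∀ u v, G (fderiv 𝕜 e y u) v + G u (fderiv 𝕜 e y v) = - G (star y u v) (e y)

/-- Periods have arbitrary differentials at `y`, so relations tested on them become identities
between vectors; after this lemma periods are not used again. -/
theorem IsAlmostFrobeniusOn.shiftIdentities {r : ℕ∞ω} (hr : ∞ ≤ r) {d : 𝕜} {U : Set V}
    (hU : IsOpen U) {G : V →L[𝕜] V →L[𝕜] 𝕜} {star : V → V →L[𝕜] V →L[𝕜] V} {E e : V → V}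
    (halg : ∀ y ∈ U, IsFrobeniusAlgebra (star y) G (E y))
    (h : IsAlmostFrobeniusOn r d U G star E e) {y : V} (hy : y ∈ U) :
    ShiftIdentities star G e y := by
  have hone : ContDiffOn 𝕜 1 star U :=
    h.contDiffOn_mul.of_le ((by exact_mod_cast natCast_le_infty 1 : (1 : ℕ∞ω) ≤ ∞).trans hr)
  have htwo : ContDiffOn 𝕜 2 e U :=
    h.contDiffOn_shift.of_le ((by exact_mod_cast natCast_le_infty 2 : (2 : ℕ∞ω) ≤ ∞).trans hr)
  have hstar : ∀ z ∈ U, DifferentiableAt 𝕜 star z := fun z hz =>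
    (hone.differentiableOn one_ne_zero).differentiableAt (hU.mem_nhds hz)
  have he : DifferentiableAt 𝕜 e y :=
    (htwo.differentiableOn two_ne_zero).differentiableAt (hU.mem_nhds hy)
  obtain ⟨F, hF, hFG, -⟩ := h.potential
  have hsymm : ∀ z ∈ U, ∀ u v, fderiv 𝕜 star z u v = fderiv 𝕜 star z v u := fun z hz u v =>
    fderiv_mul_symm hr hU halg hstar hF hFG hz u v
  have hA := halg y hy
  have hsecond : ∀ u v, fderiv 𝕜 (fderiv 𝕜 e) y u v = - fderiv 𝕜 e y (star y u v) := fun u v => by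
    refine hA.injective fun z => ?_
    have hp := isTwistedPeriod_zero star U (G z)
    have h1 := hp.shift_relation hU (h.shift U subset_rfl hU 0 _ hp) hy hstar htwo u v
    simp only [ContinuousLinearMap.fderiv, zero_smul, add_zero, zero_add, zero_sub, neg_smul,
      one_smul, sub_neg_eq_add] at h1
    rw [hA.form_symm, hA.form_symm _ z, ← sub_eq_zero, ← map_sub, sub_neg_eq_add]
    exact h1
  set κ : 𝕜 := (1 - d) / 2
  -- The relation below is divided by `ν`; the other two values obstruct the construction of periods
  -- with parameters `ν` and `1 - ν`.
  obtain ⟨ν, hν⟩ := Infinite.exists_notMem_finset ({0, -κ, 1 + κ} : Finset 𝕜)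
  simp only [Finset.mem_insert, Finset.mem_singleton, not_or] at hν
  obtain ⟨hν0, hν1, hν2⟩ := hν
  have halg' : ∀ z ∈ U, IsFrobeniusAlgebra (star z) G (κ • z) := fun z hz =>
    h.euler z hz ▸ halg z hz
  have : CompleteSpace V := FiniteDimensional.complete 𝕜 V
  have hex := fun ξ : V => exists_isTwistedPeriod (κ := κ) (ν := ν)
    (fun h0 => hν1 (eq_neg_of_add_eq_zero_left h0)) hU halg' hone hsymm hy ξ
  have hex' := fun ξ : V => exists_isTwistedPeriod (κ := κ) (ν := 1 - ν)
    (fun h0 => hν2 (by linear_combination -h0)) hU halg' hone hsymm hy ξ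
  refine ⟨hsymm y hy, hsecond, fun u v => ?_, fun u v => ?_⟩
  · refine hA.injective fun z => ?_
    obtain ⟨W, hWU, hW, hyW, p, hp, hpz⟩ := hex z
    have h1 := hp.shift_relation hW (h.shift W hWU hW ν p hp) hyW
      (fun z hz => hstar z (hWU hz)) (htwo.mono hWU) u v
    rw [hpz, hsecond] at h1
    rw [hA.form_symm, hA.form_symm _ z]
    simp only [map_sub, map_add, map_smul, map_neg, smul_eq_mul, smul_add] at h1 ⊢
    -- By associativity the terms quadratic in `ν` cancel, leaving an overall factor `ν`.
    rw [← hA.mul_assoc] at h1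
    refine mul_left_cancel₀ hν0 ?_
    linear_combination h1
  · obtain ⟨W, hWU, hW, hyW, p, hp, hpz⟩ := hex u
    obtain ⟨W', hWU', hW', hyW', q, hq, hqz⟩ := hex' v
    have hO := hW.inter hW'
    have hp' : IsTwistedPeriod star ν (W ∩ W') p :=
      ⟨hp.1.mono inter_subset_left, fun y hy => hp.2 y hy.1⟩
    have hq' : IsTwistedPeriod star (1 - ν) (W ∩ W') q :=
      ⟨hq.1.mono inter_subset_right, fun y hy => hq.2 y hy.2⟩
    have hG := isInvertible_of_nondegenerate hA.form_nondegenerate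
    have h1 := h.shift_pairing (W ∩ W') (inter_subset_left.trans hWU) hO ν p q hp' hq' y
      ⟨hyW, hyW'⟩
    unfold cometric at h1
    -- Pairing a covector with `G v` evaluates it at `v`. The parameters `ν` and `1 - ν` then add up
    -- to the coefficient `1` of the right-hand side.
    rw [hpz, hqz, hG.inverse_apply_self, hA.form_symm u, hG.self_apply_inverse,
      hp.fderiv_along hW hyW he, hq.fderiv_along hW' hyW' he, hpz, hqz] at h1
    have h2 : G u (star y v (e y)) = G (star y u v) (e y) := (hA.form_invariant u v (e y)).symm
    have h3 : G v (star y u (e y)) = G (star y u v) (e y) := by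
      rw [← hA.form_invariant, hA.mul_comm]
    simp only [map_add, map_smul, smul_eq_mul, h2, h3] at h1
    rw [hA.form_symm _ v]
    linear_combination h1

end ShiftIdentities

/-! ### The quotient structure in flat coordinates and its Levi-Civita connection. -/

section Quotient

open Set Filter Topology

variable {𝕜 V : Type*} [RCLike 𝕜] [NormedAddCommGroup V] [NormedSpace 𝕜 V]

/-- The product `star` and the constant metric `G` in flat coordinates, with unity `E` and
invertible field `e` that satisfies the identities of a shift, together with the product `mul` and
the metric `g` obtained from them by division by `e`. -/
structure IsShiftQuotient (r : ℕ∞ω) (U : Set V) (G : V →L[𝕜] V →L[𝕜] 𝕜)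
    (star : V → V →L[𝕜] V →L[𝕜] V) (E e : V → V) (g : V → V →L[𝕜] V →L[𝕜] 𝕜)
    (mul : V → V →L[𝕜] V →L[𝕜] V) : Prop where
  isOpen : IsOpen U
  order : ∞ ≤ r
  algebra : ∀ y ∈ U, IsFrobeniusAlgebra (star y) G (E y)
  invertible : ∀ y ∈ U, ∃ b, star y (e y) b = E y
  contDiffOn_star : ContDiffOn 𝕜 r star U
  contDiffOn_shift : ContDiffOn 𝕜 r e U
  identities : ∀ y ∈ U, ShiftIdentities star G e y
  form_eq : ∀ y ∈ U, g y = quotForm (star y) G (e y)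
  mul_eq : ∀ y ∈ U, mul y = quotMul (star y) (e y)

namespace IsShiftQuotient

variable {r : ℕ∞ω} {U : Set V} {G : V →L[𝕜] V →L[𝕜] 𝕜} {star : V → V →L[𝕜] V →L[𝕜] V} {E e : V → V}
  {g : V → V →L[𝕜] V →L[𝕜] 𝕜} {mul : V → V →L[𝕜] V →L[𝕜] V} {y : V}

theorem order_ne_zero (h : IsShiftQuotient r U G star E e g mul) : r ≠ 0 := by
  rintro rfl
  exact absurd h.order (by simp)

theorem differentiableAt_of_contDiffOn {W : Type*} [NormedAddCommGroup W] [NormedSpace 𝕜 W]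
    (h : IsShiftQuotient r U G star E e g mul) {f : V → W} (hf : ContDiffOn 𝕜 r f U) (hy : y ∈ U) :
    DifferentiableAt 𝕜 f y :=
  (hf.differentiableOn h.order_ne_zero).differentiableAt (h.isOpen.mem_nhds hy)

theorem isInvertible (h : IsShiftQuotient r U G star E e g mul) (hy : y ∈ U) :
    (star y (e y)).IsInvertible := by
  obtain ⟨b, hb⟩ := h.invertible y hy
  have hA := h.algebra y hy
  refine ⟨ContinuousLinearEquiv.equivOfInverse (star y (e y)) (star y b) (fun x => ?_) fun x => ?_,
    by ext x; rfl⟩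
  · rw [hA.mul_left_comm, hA.mul_mul_cancel hb]
  · exact hA.mul_mul_cancel hb x

theorem contDiffOn_divBy [CompleteSpace V] (h : IsShiftQuotient r U G star E e g mul) :
    ContDiffOn 𝕜 r (fun z => divBy (star z) (e z)) U := fun y hy => by
  obtain ⟨t, ht⟩ := h.isInvertible hy
  have h1 : ContDiffWithinAt 𝕜 r (fun z => star z (e z)) U y :=
    (h.contDiffOn_star y hy).clm_apply (h.contDiffOn_shift y hy)
  have h2 : ContDiffAt 𝕜 r ContinuousLinearMap.inverse (star y (e y)) := by
    rw [← ht]; exact contDiffAt_map_inverse t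
  exact h2.comp_contDiffWithinAt y h1

theorem contDiffOn_mul [CompleteSpace V] (h : IsShiftQuotient r U G star E e g mul) :
    ContDiffOn 𝕜 r mul U := by
  have h1 : ContDiffOn 𝕜 r
      (fun z => (ContinuousLinearMap.compL 𝕜 V V V (divBy (star z) (e z))).comp (star z)) U :=
    ((ContinuousLinearMap.compL 𝕜 V V V).contDiff.comp_contDiffOn h.contDiffOn_divBy).clm_comp
      h.contDiffOn_star
  exact h1.congr h.mul_eq

theorem contDiffOn_form [CompleteSpace V] (h : IsShiftQuotient r U G star E e g mul) :
    ContDiffOn 𝕜 r g U := by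
  -- Invariance moves the division to the first argument, where it becomes a composition with the
  -- constant `G`.
  have h1 : ContDiffOn 𝕜 r (fun z => G.comp (divBy (star z) (e z))) U :=
    contDiffOn_const.clm_comp h.contDiffOn_divBy
  refine h1.congr fun z hz => ?_
  obtain ⟨b, hb⟩ := h.invertible z hz
  have hA := h.algebra z hz
  ext u v
  rw [h.form_eq z hz, hA.quotForm_eq hb, ContinuousLinearMap.comp_apply, hA.divBy_apply hb,
    hA.mul_comm b u, hA.form_invariant]

theorem frobenius (h : IsShiftQuotient r U G star E e g mul) (hy : y ∈ U) :
    IsFrobeniusAlgebra (mul y) (g y) (e y) := by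
  obtain ⟨b, hb⟩ := h.invertible y hy
  rw [h.mul_eq y hy, h.form_eq y hy]
  exact (h.algebra y hy).quot hb

theorem mul_apply (h : IsShiftQuotient r U G star E e g mul) (hy : y ∈ U) {b : V}
    (hb : star y (e y) b = E y) (u v : V) : mul y u v = star y b (star y u v) := by
  rw [h.mul_eq y hy, (h.algebra y hy).quotMul_eq hb]

theorem form_apply (h : IsShiftQuotient r U G star E e g mul) (hy : y ∈ U) {b : V}
    (hb : star y (e y) b = E y) (u v : V) : g y u v = G u (star y b v) := by
  rw [h.form_eq y hy, (h.algebra y hy).quotForm_eq hb]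

/-- The differential of the product is symmetric in all arguments. -/
theorem fderiv_star_comm (h : IsShiftQuotient r U G star E e g mul) (hy : y ∈ U) (u v w : V) :
    fderiv 𝕜 star y u v w = fderiv 𝕜 star y u w v := by
  have hd := h.differentiableAt_of_contDiffOn h.contDiffOn_star hy
  rw [← fderiv_bilin_const_apply hd, ← fderiv_bilin_const_apply hd]
  have h1 : (fun z => star z v w) =ᶠ[𝓝 y] fun z => star z w v :=
    Filter.eventually_of_mem (h.isOpen.mem_nhds hy) fun z hz => (h.algebra z hz).mul_comm v w
  rw [h1.fderiv_eq]

/-- The differential of the division by the shift field. -/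
theorem fderiv_divBy [CompleteSpace V] (h : IsShiftQuotient r U G star E e g mul) (hy : y ∈ U)
    {b : V} (hb : star y (e y) b = E y) (u w : V) :
    fderiv 𝕜 (fun z => divBy (star z) (e z)) y u w =
      - star y b (fderiv 𝕜 e y (star y b (star y u w))) + star y b (star y u w)
        + star y b (star y u (fderiv 𝕜 e y (star y b w))) := by
  have hA := h.algebra y hy
  have hs := h.differentiableAt_of_contDiffOn h.contDiffOn_star hy
  have he := h.differentiableAt_of_contDiffOn h.contDiffOn_shift hy
  have hB := h.differentiableAt_of_contDiffOn h.contDiffOn_divBy hy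
  set v := star y b w with hv
  have hev : star y (e y) v = w := hA.mul_mul_cancel hb w
  -- The identity `(e * v) / e = v` is differentiated with `v = w / e` frozen at its value at `y`.
  have h1 : (fun z => divBy (star z) (e z) (star z (e z) v)) =ᶠ[𝓝 y] fun _ => v :=
    Filter.eventually_of_mem (h.isOpen.mem_nhds hy) fun z hz =>
      (h.isInvertible hz).inverse_apply_self v
  have h2 : DifferentiableAt 𝕜 (fun z => star z (e z) v) y :=
    (hs.clm_apply he).clm_apply (differentiableAt_const v)
  have h3 := congrArg (fun t : V →L[𝕜] V => t u) h1.fderiv_eq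
  simp only [fderiv_clm_apply hB h2, _root_.add_apply, ContinuousLinearMap.comp_apply,
    ContinuousLinearMap.flip_apply, fderiv_bilin_apply hs he (differentiableAt_const v),
    fderiv_fun_const, Pi.zero_apply, _root_.zero_apply, map_zero, add_zero, hev] at h3
  rw [hA.divBy_apply hb, h.fderiv_star_comm hy] at h3
  have h4 := (h.identities y hy).leibniz u v
  have h5 : star y (star y u v) (e y) = star y u w := by
    rw [hA.mul_assoc, hA.mul_comm v, hev]
  rw [h5] at h4
  -- The Leibniz identity removes the differential of `star`, so only `De` remains.
  have h6 : fderiv 𝕜 star y u v (e y) + star y (fderiv 𝕜 e y u) v =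
      fderiv 𝕜 e y (star y u v) - star y u w - star y u (fderiv 𝕜 e y v) := by
    rw [hA.mul_comm _ v, ← h4]; abel
  rw [h6, add_comm, ← eq_neg_iff_add_eq_zero] at h3
  have h7 : star y b (star y u w) = star y u v := by rw [hv, hA.mul_left_comm]
  rw [h3, map_sub, map_sub, h7]
  abel

/-- The differential of the quotient product. -/
theorem fderiv_mul_apply [CompleteSpace V] (h : IsShiftQuotient r U G star E e g mul) (hy : y ∈ U)
    {b : V} (hb : star y (e y) b = E y) (u v w : V) :
    fderiv 𝕜 mul y u v w =
      - star y b (fderiv 𝕜 e y (star y b (star y u (star y v w))))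
        + star y b (star y u (star y v w))
        + star y b (star y u (fderiv 𝕜 e y (star y b (star y v w))))
        + star y b (fderiv 𝕜 star y u v w) := by
  have hs := h.differentiableAt_of_contDiffOn h.contDiffOn_star hy
  have hB := h.differentiableAt_of_contDiffOn h.contDiffOn_divBy hy
  have h1 : (fun z => mul z v w) =ᶠ[𝓝 y] fun z => divBy (star z) (e z) (star z v w) :=
    Filter.eventually_of_mem (h.isOpen.mem_nhds hy) fun z hz => by
      simp only [h.mul_eq z hz]; rfl
  have h2 : DifferentiableAt 𝕜 (fun z => star z v w) y :=
    (hs.clm_apply (differentiableAt_const v)).clm_apply (differentiableAt_const w)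
  rw [← fderiv_bilin_const_apply (h.differentiableAt_of_contDiffOn h.contDiffOn_mul hy),
    h1.fderiv_eq, fderiv_clm_apply hB h2]
  simp only [_root_.add_apply, ContinuousLinearMap.comp_apply, ContinuousLinearMap.flip_apply,
    fderiv_bilin_const_apply hs, h.fderiv_divBy hy hb, (h.algebra y hy).divBy_apply hb]
  abel

/-- The differential of the quotient metric. -/
theorem fderiv_form_apply [CompleteSpace V] (h : IsShiftQuotient r U G star E e g mul) (hy : y ∈ U)
    {b : V} (hb : star y (e y) b = E y) (u v w : V) :
    fderiv 𝕜 g y u v w = G v (- star y b (fderiv 𝕜 e y (star y b (star y u w)))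
      + star y b (star y u w) + star y b (star y u (fderiv 𝕜 e y (star y b w)))) := by
  have hB := h.differentiableAt_of_contDiffOn h.contDiffOn_divBy hy
  have h1 : (fun z => g z v w) =ᶠ[𝓝 y] fun z => G v (divBy (star z) (e z) w) :=
    Filter.eventually_of_mem (h.isOpen.mem_nhds hy) fun z hz => by
      simp only [h.form_eq z hz]; rfl
  have h2 : DifferentiableAt 𝕜 (fun z => divBy (star z) (e z) w) y :=
    hB.clm_apply (differentiableAt_const w)
  have h3 : HasFDerivAt (fun z => G v (divBy (star z) (e z) w)) _ y :=
    (G v).hasFDerivAt.comp y h2.hasFDerivAt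
  rw [← fderiv_bilin_const_apply (h.differentiableAt_of_contDiffOn h.contDiffOn_form hy),
    h1.fderiv_eq, h3.fderiv, ContinuousLinearMap.comp_apply, fderiv_apply_const hB,
    h.fderiv_divBy hy hb]

/-- The quotient metric is parallel for the connection `∇_u v = D_u v - D_{u · v} e`. -/
theorem fderiv_form_eq [CompleteSpace V] (h : IsShiftQuotient r U G star E e g mul) (hy : y ∈ U)
    (u v w : V) :
    fderiv 𝕜 g y u v w = - g y (fderiv 𝕜 e y (mul y u v)) w - g y v (fderiv 𝕜 e y (mul y u w)) := by
  obtain ⟨b, hb⟩ := h.invertible y hy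
  have hA := h.algebra y hy
  -- Adjointness is applied to `u · v` and `w / e`; multiplying the latter by `e` restores `w`.
  have hI := (h.identities y hy).adjoint (star y b (star y u v)) (star y b w)
  have hadj : ∀ a x z, G (star y a x) z = G x (star y a z) := fun a x z => by
    rw [hA.mul_comm, hA.form_invariant]
  have h1 : star y (star y b w) (e y) = w := by
    rw [hA.mul_comm, hA.mul_mul_cancel hb]
  have h2 : ∀ z, G (star y b (star y u v)) z = G v (star y b (star y u z)) := fun z => by
    rw [hadj, hadj, hA.mul_left_comm]
  rw [hA.form_invariant _ (star y b w), h1, h2, h2] at hI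
  rw [h.fderiv_form_apply hy hb]
  simp only [h.form_apply hy hb, h.mul_apply hy hb, map_add, map_neg]
  linear_combination hI

/-- The Levi-Civita connection of the quotient metric. -/
theorem christoffel_eq [FiniteDimensional 𝕜 V] (h : IsShiftQuotient r U G star E e g mul)
    (hy : y ∈ U) (u v : V) : christoffel g y u v = - fderiv 𝕜 e y (mul y u v) := by
  have : CompleteSpace V := FiniteDimensional.complete 𝕜 V
  have hF := h.frobenius hy
  have hinv := isInvertible_of_nondegenerate hF.form_nondegenerate
  unfold christoffel
  rw [hinv.inverse_apply_eq]
  ext w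
  simp only [_root_.add_apply, _root_.sub_apply, _root_.smul_apply, ContinuousLinearMap.flip_apply,
    h.fderiv_form_eq hy, map_neg, _root_.neg_apply, smul_eq_mul]
  -- Of the six terms in the Koszul formula four cancel in pairs, and the other two both equal
  -- `-g(De(u · v), w)`.
  rw [hF.mul_comm v u, hF.mul_comm w u, hF.mul_comm w v,
    hF.form_symm u, hF.form_symm v (fderiv 𝕜 e y (mul y u w))]
  ring

theorem differentiableAt_fderiv_shift (h : IsShiftQuotient r U G star E e g mul) (hy : y ∈ U) :
    DifferentiableAt 𝕜 (fderiv 𝕜 e) y := by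
  have h2 : (1 + 1 : ℕ∞ω) ≤ r :=
    (by exact_mod_cast natCast_le_infty (1 + 1) : (1 + 1 : ℕ∞ω) ≤ ∞).trans h.order
  exact (((h.contDiffOn_shift y hy).contDiffAt (h.isOpen.mem_nhds hy)).fderiv_right h2).differentiableAt
    one_ne_zero

/-- The product of a vector with the quotient product of two vectors is symmetric. -/
theorem star_mul_comm (h : IsShiftQuotient r U G star E e g mul) (hy : y ∈ U) (u v w : V) :
    star y u (mul y v w) = star y v (mul y u w) := by
  obtain ⟨b, hb⟩ := h.invertible y hy
  have hA := h.algebra y hy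
  rw [h.mul_apply hy hb, h.mul_apply hy hb, hA.mul_left_comm u b, hA.mul_left_comm v b,
    hA.mul_left_comm u v]

theorem tensorC_left_comm (h : IsShiftQuotient r U G star E e g mul) (hy : y ∈ U) (u v w : V) :
    tensorC g mul y u v w = tensorC g mul y v u w := by
  rw [tensorC, tensorC, (h.frobenius hy).mul_comm]

theorem tensorC_right_comm (h : IsShiftQuotient r U G star E e g mul) (hy : y ∈ U) (u v w : V) :
    tensorC g mul y u v w = tensorC g mul y u w v := by
  have hF := h.frobenius hy
  rw [tensorC, tensorC, hF.mul_comm, hF.form_invariant, hF.form_symm]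

theorem fderiv_euler {κ : 𝕜} (h : IsShiftQuotient r U G star E e g mul) (hE : ∀ z ∈ U, E z = κ • z)
    (hy : y ∈ U) (u : V) : DifferentiableAt 𝕜 E y ∧ fderiv 𝕜 E y u = κ • u := by
  have h1 : E =ᶠ[𝓝 y] fun z => κ • z := Filter.eventually_of_mem (h.isOpen.mem_nhds hy) hE
  have h2 : HasFDerivAt E (κ • ContinuousLinearMap.id 𝕜 V) y :=
    ((hasFDerivAt_id y).const_smul κ).congr_of_eventuallyEq h1
  exact ⟨h2.differentiableAt, by rw [h2.fderiv]; simp⟩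

/-- The product in flat coordinates is homogeneous. -/
theorem fderiv_star_euler {κ : 𝕜} (h : IsShiftQuotient r U G star E e g mul) (hE : ∀ z ∈ U, E z = κ • z)
    (hy : y ∈ U) (u v : V) : fderiv 𝕜 star y u v (E y) = - κ • star y u v := by
  have hA := h.algebra y hy
  obtain ⟨hd, hE'⟩ := h.fderiv_euler hE hy u
  have h1 : (fun z => star z (E z) v) =ᶠ[𝓝 y] fun _ => v :=
    Filter.eventually_of_mem (h.isOpen.mem_nhds hy) fun z hz => (h.algebra z hz).one_mul v
  have h2 := congrArg (fun t : V →L[𝕜] V => t u) h1.fderiv_eq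
  simp only [fderiv_bilin_apply (h.differentiableAt_of_contDiffOn h.contDiffOn_star hy) hd
    (differentiableAt_const v), hE', fderiv_fun_const, Pi.zero_apply, _root_.zero_apply, map_zero,
    add_zero, map_smul, _root_.smul_apply] at h2
  rw [h.fderiv_star_comm hy, neg_smul]
  exact eq_neg_of_add_eq_zero_left h2

end IsShiftQuotient

end Quotient

/-! ### The axioms of a Frobenius structure for the quotient. -/

section QuotientAxioms

open Set Filter Topology

variable {𝕜 V : Type*} [RCLike 𝕜] [NormedAddCommGroup V] [NormedSpace 𝕜 V] [FiniteDimensional 𝕜 V]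

namespace IsShiftQuotient

variable {r : ℕ∞ω} {U : Set V} {G : V →L[𝕜] V →L[𝕜] 𝕜} {star : V → V →L[𝕜] V →L[𝕜] V} {E e : V → V}
  {g : V → V →L[𝕜] V →L[𝕜] 𝕜} {mul : V → V →L[𝕜] V →L[𝕜] V} {y : V}

theorem differentiableAt_mul (h : IsShiftQuotient r U G star E e g mul) (hy : y ∈ U) :
    DifferentiableAt 𝕜 mul y :=
  have : CompleteSpace V := FiniteDimensional.complete 𝕜 V
  h.differentiableAt_of_contDiffOn h.contDiffOn_mul hy

theorem differentiableAt_form (h : IsShiftQuotient r U G star E e g mul) (hy : y ∈ U) :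
    DifferentiableAt 𝕜 g y :=
  have : CompleteSpace V := FiniteDimensional.complete 𝕜 V
  h.differentiableAt_of_contDiffOn h.contDiffOn_form hy

/-- In the formula for the differential of `mul` the other terms are symmetric in `u` and `v`. This
one antisymmetrization yields both zero curvature (after applying `De`) and the symmetry of `∇c`. -/
theorem fderiv_mul_sub_fderiv_mul (h : IsShiftQuotient r U G star E e g mul) (hy : y ∈ U)
    (u v w : V) :
    fderiv 𝕜 mul y u v w - fderiv 𝕜 mul y v u w =
      mul y u (fderiv 𝕜 e y (mul y v w)) - mul y v (fderiv 𝕜 e y (mul y u w)) := by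
  have : CompleteSpace V := FiniteDimensional.complete 𝕜 V
  obtain ⟨b, hb⟩ := h.invertible y hy
  have hA := h.algebra y hy
  rw [h.fderiv_mul_apply hy hb, h.fderiv_mul_apply hy hb, (h.identities y hy).symm u v,
    hA.mul_left_comm v u w]
  simp only [h.mul_apply hy hb]
  abel

/-- The relation `D²e(u, v) = -De(u * v)` replaces the second derivative of `e`; the resulting term
is symmetric in `u` and `v`, so it drops out of the curvature. -/
theorem fderiv_christoffel (h : IsShiftQuotient r U G star E e g mul) (hy : y ∈ U) (u v w : V) :
    fderiv 𝕜 (fun z => christoffel g z v w) y u =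
      fderiv 𝕜 e y (star y u (mul y v w)) - fderiv 𝕜 e y (fderiv 𝕜 mul y u v w) := by
  have h1 : (fun z => christoffel g z v w) =ᶠ[𝓝 y] fun z => - fderiv 𝕜 e z (mul z v w) :=
    Filter.eventually_of_mem (h.isOpen.mem_nhds hy) fun z hz => h.christoffel_eq hz v w
  have h2 : DifferentiableAt 𝕜 (fun z => mul z v w) y :=
    ((h.differentiableAt_mul hy).clm_apply (differentiableAt_const v)).clm_apply
      (differentiableAt_const w)
  rw [h1.fderiv_eq, fderiv_fun_neg, fderiv_clm_apply (h.differentiableAt_fderiv_shift hy) h2]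
  simp only [_root_.add_apply, _root_.neg_apply, ContinuousLinearMap.comp_apply,
    ContinuousLinearMap.flip_apply, fderiv_bilin_const_apply (h.differentiableAt_mul hy),
    (h.identities y hy).second]
  abel

/-- The quotient metric is flat. -/
theorem curvature_eq_zero (h : IsShiftQuotient r U G star E e g mul) (hy : y ∈ U) (u v w : V) :
    curvature g y u v w = 0 := by
  have h1 := congrArg (fderiv 𝕜 e y) (h.fderiv_mul_sub_fderiv_mul hy u v w)
  rw [map_sub, map_sub] at h1
  unfold curvature
  rw [h.fderiv_christoffel hy, h.fderiv_christoffel hy, h.star_mul_comm hy u v]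
  simp only [h.christoffel_eq hy, map_neg, neg_neg]
  rw [← sub_eq_zero] at h1
  rw [← neg_eq_zero, ← h1]
  abel

/-- The shift field is parallel. -/
theorem covDeriv_shift (h : IsShiftQuotient r U G star E e g mul) (hy : y ∈ U) (u : V) :
    covDeriv g e y u = 0 := by
  have hF := h.frobenius hy
  rw [covDeriv, h.christoffel_eq hy, hF.mul_comm, hF.one_mul, add_neg_cancel]

/-- Since the metric is parallel, `∇c` is the metric applied to the covariant derivative of the
product. -/
theorem nablaC_eq (h : IsShiftQuotient r U G star E e g mul) (hy : y ∈ U) (w u v z : V) :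
    nablaC g mul y w u v z = g y (fderiv 𝕜 mul y w u v + mul y u (fderiv 𝕜 e y (mul y w v))
      + mul y (fderiv 𝕜 e y (mul y w u)) v - fderiv 𝕜 e y (mul y w (mul y u v))) z := by
  have : CompleteSpace V := FiniteDimensional.complete 𝕜 V
  have h2 : DifferentiableAt 𝕜 (fun z => mul z u v) y :=
    ((h.differentiableAt_mul hy).clm_apply (differentiableAt_const u)).clm_apply
      (differentiableAt_const v)
  unfold nablaC tensorC
  rw [fderiv_bilin_apply (h.differentiableAt_form hy) h2 (differentiableAt_const z),
    fderiv_bilin_const_apply (h.differentiableAt_mul hy), h.fderiv_form_eq hy]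
  simp only [h.christoffel_eq hy, map_neg, _root_.neg_apply, map_add, map_sub, _root_.add_apply,
    _root_.sub_apply, fderiv_fun_const, Pi.zero_apply, _root_.zero_apply, map_zero]
  ring

/-- The covariant derivative of the structure tensor is symmetric. -/
theorem nablaC_symm (h : IsShiftQuotient r U G star E e g mul) (hy : y ∈ U) (w u v z : V) :
    nablaC g mul y w u v z = nablaC g mul y u w v z ∧
      nablaC g mul y w u v z = nablaC g mul y w v u z ∧
      nablaC g mul y w u v z = nablaC g mul y w u z v := by
  have hF := h.frobenius hy
  refine ⟨?_, ?_, ?_⟩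
  · rw [h.nablaC_eq hy, h.nablaC_eq hy, hF.mul_comm u w, hF.mul_left_comm u w]
    have h1 := h.fderiv_mul_sub_fderiv_mul hy w u v
    congr 3
    rw [sub_eq_iff_eq_add] at h1
    rw [h1]
    abel_nf
  -- The remaining symmetries are those of `c` itself, inherited by its covariant derivative.
  · have h1 : (fun x => tensorC g mul x u v z) =ᶠ[𝓝 y] fun x => tensorC g mul x v u z :=
      Filter.eventually_of_mem (h.isOpen.mem_nhds hy) fun x hx => h.tensorC_left_comm hx u v z
    rw [nablaC, nablaC, h1.fderiv_eq, h.tensorC_left_comm hy _ v, h.tensorC_left_comm hy u,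
      h.tensorC_left_comm hy u v]
    ring
  · have h1 : (fun x => tensorC g mul x u v z) =ᶠ[𝓝 y] fun x => tensorC g mul x u z v :=
      Filter.eventually_of_mem (h.isOpen.mem_nhds hy) fun x hx => h.tensorC_right_comm hx u v z
    rw [nablaC, nablaC, h1.fderiv_eq, h.tensorC_right_comm hy _ v, h.tensorC_right_comm hy u _ z,
      h.tensorC_right_comm hy u v]
    ring

/-! ### Homogeneity along the Euler field. -/

section Euler

variable {κ : 𝕜}

/-- In the direction of the unity `E` the two terms with `De` cancel; `-κ` is the degree of `*` and
the extra `1` comes from dividing by `e`. -/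
theorem fderiv_mul_euler (h : IsShiftQuotient r U G star E e g mul) (hE : ∀ z ∈ U, E z = κ • z)
    (hy : y ∈ U) (v w : V) : fderiv 𝕜 mul y (E y) v w = (1 - κ) • mul y v w := by
  have : CompleteSpace V := FiniteDimensional.complete 𝕜 V
  obtain ⟨b, hb⟩ := h.invertible y hy
  have hA := h.algebra y hy
  rw [h.fderiv_mul_apply hy hb, (h.identities y hy).symm, h.fderiv_star_comm hy,
    h.fderiv_star_euler hE hy, h.mul_apply hy hb]
  simp only [hA.one_mul, map_smul, map_neg, sub_smul, neg_smul, one_smul]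
  abel

theorem fderiv_form_euler (h : IsShiftQuotient r U G star E e g mul) (hy : y ∈ U) (v w : V) :
    fderiv 𝕜 g y (E y) v w = g y v w := by
  have : CompleteSpace V := FiniteDimensional.complete 𝕜 V
  obtain ⟨b, hb⟩ := h.invertible y hy
  have hA := h.algebra y hy
  rw [h.fderiv_form_apply hy hb, h.form_apply hy hb]
  simp only [hA.one_mul, neg_add_cancel_comm]

/-- The derivative of the product with the old unity. -/
theorem fderiv_mul_apply_euler (h : IsShiftQuotient r U G star E e g mul)
    (hE : ∀ z ∈ U, E z = κ • z) (hy : y ∈ U) (u v : V) :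
    fderiv 𝕜 mul y u v (E y) + κ • mul y v u = mul y u v
      + mul y u (fderiv 𝕜 e y (mul y v (E y))) - mul y (E y) (fderiv 𝕜 e y (mul y u v)) := by
  have : CompleteSpace V := FiniteDimensional.complete 𝕜 V
  obtain ⟨b, hb⟩ := h.invertible y hy
  have hA := h.algebra y hy
  have h1 : ∀ x, star y x (E y) = x := fun x => by rw [hA.mul_comm, hA.one_mul]
  rw [h.fderiv_mul_apply hy hb, h.fderiv_star_euler hE hy, (h.frobenius hy).mul_comm v]
  simp only [h.mul_apply hy hb, h1, hA.one_mul, neg_smul, map_neg, map_smul]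
  abel

/-- The Euler field is linear. -/
theorem covDerivTwo_euler (h : IsShiftQuotient r U G star E e g mul)
    (hE : ∀ z ∈ U, E z = κ • z) (hy : y ∈ U) (u v : V) : covDerivTwo g E y u v = 0 := by
  have hcov : ∀ z ∈ U, ∀ w, covDeriv g E z w = κ • w - fderiv 𝕜 e z (mul z w (E z)) :=
    fun z hz w => by
    rw [covDeriv, h.christoffel_eq hz, (h.fderiv_euler hE hz w).2, sub_eq_add_neg]
  obtain ⟨hd, hE'⟩ := h.fderiv_euler hE hy u
  have h1 : (fun z => covDeriv g E z v) =ᶠ[𝓝 y] fun z => κ • v - fderiv 𝕜 e z (mul z v (E z)) :=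
    Filter.eventually_of_mem (h.isOpen.mem_nhds hy) fun z hz => hcov z hz v
  have h2 : DifferentiableAt 𝕜 (fun z => mul z v (E z)) y :=
    ((h.differentiableAt_mul hy).clm_apply (differentiableAt_const v)).clm_apply hd
  -- Here `∇_v E = κ v - De(v · E)`, so `∇∇E` is `De` of an expression that this identity makes
  -- zero.
  have h3 := congrArg (fderiv 𝕜 e y) (h.fderiv_mul_apply_euler hE hy u v)
  have h4 : star y u (mul y v (E y)) = mul y u v := by
    obtain ⟨b, hb⟩ := h.invertible y hy
    have hA := h.algebra y hy
    rw [h.mul_apply hy hb, h.mul_apply hy hb, hA.mul_comm v, hA.one_mul, hA.mul_left_comm]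
  unfold covDerivTwo
  rw [h1.fderiv_eq, fderiv_const_sub, fderiv_clm_apply (h.differentiableAt_fderiv_shift hy) h2]
  simp only [_root_.add_apply, _root_.neg_apply, ContinuousLinearMap.comp_apply,
    ContinuousLinearMap.flip_apply,
    fderiv_bilin_apply (h.differentiableAt_mul hy) (differentiableAt_const v) hd, hE',
    (h.identities y hy).second, h4, hcov y hy, h.christoffel_eq hy, fderiv_fun_const, Pi.zero_apply,
    _root_.zero_apply, map_zero, add_zero]
  simp only [map_add, map_sub, map_smul, map_neg, _root_.neg_apply, smul_neg] at h3 ⊢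
  rw [(h.frobenius hy).mul_comm (fderiv 𝕜 e y (mul y u v)) (E y), h3]
  abel

end Euler

/-- The quotient is a Frobenius structure in the flat coordinates of the original metric. -/
theorem isFrobeniusOn {d : 𝕜} (h : IsShiftQuotient r U G star E e g mul)
    (hE : ∀ z ∈ U, E z = ((1 - d) / 2) • z) : IsFrobeniusOn r d U g mul e E where
  contDiffOn_form := have : CompleteSpace V := FiniteDimensional.complete 𝕜 V; h.contDiffOn_form
  contDiffOn_mul := have : CompleteSpace V := FiniteDimensional.complete 𝕜 V; h.contDiffOn_mul
  contDiffOn_unit := h.contDiffOn_shift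
  contDiffOn_euler := (contDiff_id.const_smul ((1 - d) / 2)).contDiffOn.congr hE
  flat y hy := h.curvature_eq_zero hy
  unit_flat y hy := h.covDeriv_shift hy
  nablaC_symm y hy := h.nablaC_symm hy
  euler_linear y hy := h.covDerivTwo_euler hE hy
  euler_mul X Y hX hY y hy := by
    -- The brackets contribute `-κ + 2κ` and the derivative of the product `1 - κ`, for a total of
    -- `1`.
    have hX' := h.differentiableAt_of_contDiffOn hX hy
    have hY' := h.differentiableAt_of_contDiffOn hY hy
    have hE' := fun u => (h.fderiv_euler hE hy u).2
    simp only [VectorField.lieBracket, fderiv_bilin_apply (h.differentiableAt_mul hy) hX' hY', hE',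
      h.fderiv_mul_euler hE hy, map_sub, map_smul, _root_.sub_apply, _root_.smul_apply, sub_smul,
      one_smul]
    abel
  euler_form X Y hX hY y hy := by
    -- The total weight is `1 + 2κ = 2 - d`.
    have hX' := h.differentiableAt_of_contDiffOn hX hy
    have hY' := h.differentiableAt_of_contDiffOn hY hy
    have hE' := fun u => (h.fderiv_euler hE hy u).2
    simp only [VectorField.lieBracket, fderiv_bilin_apply (h.differentiableAt_form hy) hX' hY', hE',
      h.fderiv_form_euler hy, map_sub, map_smul, _root_.sub_apply, _root_.smul_apply, smul_eq_mul]
    ring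

end IsShiftQuotient

end QuotientAxioms

/-! ### Transport of the algebraic structures to a chart. -/

section Charts

open Set Filter Topology

variable {𝕜 V M : Type*} [RCLike 𝕜] [NormedAddCommGroup V] [NormedSpace 𝕜 V]
  [TopologicalSpace M] [ChartedSpace V M] {r : ℕ∞ω}

theorem mdifferentiable_of_mem_maximalAtlas (hr : r ≠ 0) {φ : OpenPartialHomeomorph M V}
    (hφ : φ ∈ IsManifold.maximalAtlas 𝓘(𝕜, V) r M) : φ.MDifferentiable 𝓘(𝕜, V) 𝓘(𝕜, V) :=
  ⟨(contMDiffOn_of_mem_maximalAtlas hφ).mdifferentiableOn hr,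
    (contMDiffOn_symm_of_mem_maximalAtlas hφ).mdifferentiableOn hr⟩

/-- The differential of a chart at the point with coordinates `y`. -/
def chartDeriv (φ : OpenPartialHomeomorph M V) (y : V) : TangentSpace 𝓘(𝕜, V) (φ.symm y) →L[𝕜] V :=
  mfderiv 𝓘(𝕜, V) 𝓘(𝕜, V) φ (φ.symm y)

/-- The differential of the inverse of a chart at `y`. -/
def chartSymmDeriv (φ : OpenPartialHomeomorph M V) (y : V) :
    V →L[𝕜] TangentSpace 𝓘(𝕜, V) (φ.symm y) :=
  mfderiv 𝓘(𝕜, V) 𝓘(𝕜, V) φ.symm y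

variable {φ : OpenPartialHomeomorph M V}
  {g : ∀ x : M, TangentSpace 𝓘(𝕜, V) x →L[𝕜] TangentSpace 𝓘(𝕜, V) x →L[𝕜] 𝕜}
  {star : ∀ x : M, TangentSpace 𝓘(𝕜, V) x →L[𝕜] TangentSpace 𝓘(𝕜, V) x →L[𝕜]
    TangentSpace 𝓘(𝕜, V) x}
  {E e : ∀ x : M, TangentSpace 𝓘(𝕜, V) x} {y : V}

theorem chartForm_apply (u v : V) : chartForm φ g y u v =
    g (φ.symm y) (chartSymmDeriv φ y u) (chartSymmDeriv φ y v) := rfl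

theorem chartMul_apply (u v : V) : chartMul φ star y u v =
    chartDeriv φ y (star (φ.symm y)
      (chartSymmDeriv φ y u) (chartSymmDeriv φ y v)) := rfl

theorem chartVec_eq : chartVec φ E y = chartDeriv φ y (E (φ.symm y)) := rfl

theorem chartDeriv_chartSymmDeriv (hφ : φ.MDifferentiable 𝓘(𝕜, V) 𝓘(𝕜, V)) (hy : y ∈ φ.target) (u : V) :
    chartDeriv (𝕜 := 𝕜) φ y (chartSymmDeriv φ y u) = u :=
  congrArg (fun t : V →L[𝕜] V => t u) (hφ.comp_symm_deriv hy)

theorem chartSymmDeriv_chartDeriv (hφ : φ.MDifferentiable 𝓘(𝕜, V) 𝓘(𝕜, V)) (hy : y ∈ φ.target)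
    (u : TangentSpace 𝓘(𝕜, V) (φ.symm y)) :
    chartSymmDeriv (𝕜 := 𝕜) φ y (chartDeriv φ y u) = u := by
  have h := congrArg (fun t : V →L[𝕜] V => t u) (hφ.symm_comp_deriv (φ.map_target hy))
  rw [φ.right_inv hy] at h
  exact h

/-- A Frobenius algebra on a tangent space, in a chart. -/
theorem IsFrobeniusAlgebra.chart (hφ : φ.MDifferentiable 𝓘(𝕜, V) 𝓘(𝕜, V)) (hy : y ∈ φ.target)
    (h : IsFrobeniusAlgebra (star (φ.symm y)) (g (φ.symm y)) (E (φ.symm y))) :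
    IsFrobeniusAlgebra (chartMul φ star y) (chartForm φ g y) (chartVec φ E y) where
  mul_comm u v := by rw [chartMul_apply, chartMul_apply, h.mul_comm]
  mul_assoc u v w := by
    simp only [chartMul_apply, chartSymmDeriv_chartDeriv hφ hy, h.mul_assoc]
  one_mul u := by
    rw [chartMul_apply, chartVec_eq, chartSymmDeriv_chartDeriv hφ hy, h.one_mul, chartDeriv_chartSymmDeriv hφ hy]
  form_symm u v := by rw [chartForm_apply, chartForm_apply, h.form_symm]
  form_nondegenerate u hu := by
    have h1 := h.form_nondegenerate (chartSymmDeriv (𝕜 := 𝕜) φ y u) fun v => by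
      have h2 := hu (chartDeriv (𝕜 := 𝕜) φ y v)
      rwa [chartForm_apply, chartSymmDeriv_chartDeriv hφ hy] at h2
    rw [← chartDeriv_chartSymmDeriv (𝕜 := 𝕜) hφ hy u, h1, map_zero]
  form_invariant u v w := by
    simp only [chartMul_apply, chartForm_apply, chartSymmDeriv_chartDeriv hφ hy, h.form_invariant]

theorem chartMul_chartVec (hφ : φ.MDifferentiable 𝓘(𝕜, V) 𝓘(𝕜, V)) (hy : y ∈ φ.target)
    {b : TangentSpace 𝓘(𝕜, V) (φ.symm y)} (hb : star (φ.symm y) (e (φ.symm y)) b = E (φ.symm y)) :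
    chartMul φ star y (chartVec φ e y) (chartDeriv φ y b) =
      chartVec φ E y := by
  rw [chartMul_apply, chartVec_eq, chartSymmDeriv_chartDeriv hφ hy, chartSymmDeriv_chartDeriv hφ hy, hb, chartVec_eq]

theorem chartMul_quotMul (hφ : φ.MDifferentiable 𝓘(𝕜, V) 𝓘(𝕜, V)) (hy : y ∈ φ.target)
    (h : IsFrobeniusAlgebra (star (φ.symm y)) (g (φ.symm y)) (E (φ.symm y)))
    {b : TangentSpace 𝓘(𝕜, V) (φ.symm y)} (hb : star (φ.symm y) (e (φ.symm y)) b = E (φ.symm y)) :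
    chartMul φ (fun x => quotMul (star x) (e x)) y =
      quotMul (chartMul φ star y) (chartVec φ e y) := by
  refine ContinuousLinearMap.ext fun u => ContinuousLinearMap.ext fun v => ?_
  rw [(h.chart hφ hy).quotMul_eq (chartMul_chartVec hφ hy hb), chartMul_apply, h.quotMul_eq hb,
    chartMul_apply, chartMul_apply, chartSymmDeriv_chartDeriv hφ hy, chartSymmDeriv_chartDeriv hφ hy]

theorem chartForm_quotForm (hφ : φ.MDifferentiable 𝓘(𝕜, V) 𝓘(𝕜, V)) (hy : y ∈ φ.target)
    (h : IsFrobeniusAlgebra (star (φ.symm y)) (g (φ.symm y)) (E (φ.symm y)))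
    {b : TangentSpace 𝓘(𝕜, V) (φ.symm y)} (hb : star (φ.symm y) (e (φ.symm y)) b = E (φ.symm y)) :
    chartForm φ (fun x => quotForm (star x) (g x) (e x)) y =
      quotForm (chartMul φ star y) (chartForm φ g y) (chartVec φ e y) := by
  refine ContinuousLinearMap.ext fun u => ContinuousLinearMap.ext fun v => ?_
  rw [(h.chart hφ hy).quotForm_eq (chartMul_chartVec hφ hy hb), chartForm_apply, h.quotForm_eq hb,
    chartForm_apply, chartMul_apply, chartSymmDeriv_chartDeriv hφ hy, chartSymmDeriv_chartDeriv hφ hy]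

end Charts

end AlmostDuality

end

/-! ### The reconstruction theorem on the manifold. -/

theorem mainTheorem3 {𝕜 V M : Type*} [RCLike 𝕜] [NormedAddCommGroup V] [NormedSpace 𝕜 V]
    [FiniteDimensional 𝕜 V] [TopologicalSpace M] [ChartedSpace V M]
    (r : ℕ∞ω) (hr : ∞ ≤ r) [IsManifold 𝓘(𝕜, V) r M]
    (d : 𝕜) (hd : d ≠ 1)
    (g : ∀ x : M, TangentSpace 𝓘(𝕜, V) x →L[𝕜] TangentSpace 𝓘(𝕜, V) x →L[𝕜] 𝕜)
    (star : ∀ x : M, TangentSpace 𝓘(𝕜, V) x →L[𝕜] TangentSpace 𝓘(𝕜, V) x →L[𝕜]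
      TangentSpace 𝓘(𝕜, V) x)
    (E e : ∀ x : M, TangentSpace 𝓘(𝕜, V) x)
    (h : AlmostDuality.IsAlmostFrobeniusStructure r d g star E e)
    (mul : ∀ x : M, TangentSpace 𝓘(𝕜, V) x →L[𝕜] TangentSpace 𝓘(𝕜, V) x →L[𝕜]
      TangentSpace 𝓘(𝕜, V) x)
    (hmul : ∀ x, mul x = AlmostDuality.quotMul (star x) (e x))
    (η : ∀ x : M, TangentSpace 𝓘(𝕜, V) x →L[𝕜] TangentSpace 𝓘(𝕜, V) x →L[𝕜] 𝕜)
    (hη : ∀ x, η x = AlmostDuality.quotForm (star x) (g x) (e x)) :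
    AlmostDuality.IsFrobeniusStructure r d η mul e E ∧
      ∀ x : M, (∃ b, mul x (E x) b = e x) ∧
        AlmostDuality.quotMul (mul x) (E x) = star x ∧
        AlmostDuality.quotForm (mul x) (η x) (E x) = g x := by
  obtain rfl : mul = fun x => AlmostDuality.quotMul (star x) (e x) := funext hmul
  obtain rfl : η = fun x => AlmostDuality.quotForm (star x) (g x) (e x) := funext hη
  have hA := h.frobenius_algebra
  refine ⟨⟨fun x => ?_, fun x => ?_⟩, fun x => ?_⟩
  · obtain ⟨b, hb⟩ := h.shift_invertible x
    exact (hA x).quot hb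
  · obtain ⟨φ, hφ, hx, G, hG, hF⟩ := h.flat_coordinates x
    have hr0 : r ≠ 0 := by
      rintro rfl
      exact absurd hr (by simp)
    have hφ' := AlmostDuality.mdifferentiable_of_mem_maximalAtlas hr0 hφ
    have halg : ∀ y ∈ φ.target, AlmostDuality.IsFrobeniusAlgebra (AlmostDuality.chartMul φ star y) G
        (AlmostDuality.chartVec φ E y) := fun y hy =>
      hG y hy ▸ (hA (φ.symm y)).chart hφ' hy
    -- The flat charts of the original metric also serve for the new structure, whose own metric is
    -- not constant in them in general; its axioms are tensorial.
    refine ⟨φ, hφ, hx, AlmostDuality.IsShiftQuotient.isFrobeniusOn (G := G)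
      (star := AlmostDuality.chartMul φ star) ⟨φ.open_target, hr, halg, fun y hy => ?_,
        hF.contDiffOn_mul, hF.contDiffOn_shift,
        fun y hy => hF.shiftIdentities hr φ.open_target halg hy, fun y hy => ?_, fun y hy => ?_⟩
      hF.euler⟩
    · obtain ⟨b, hb⟩ := h.shift_invertible (φ.symm y)
      exact ⟨_, AlmostDuality.chartMul_chartVec hφ' hy hb⟩
    · obtain ⟨b, hb⟩ := h.shift_invertible (φ.symm y)
      rw [AlmostDuality.chartForm_quotForm hφ' hy (hA _) hb, hG y hy]
    · obtain ⟨b, hb⟩ := h.shift_invertible (φ.symm y)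
      exact AlmostDuality.chartMul_quotMul hφ' hy (hA _) hb
  · obtain ⟨b, hb⟩ := h.shift_invertible x
    exact ⟨⟨_, (hA x).quotMul_one_mul_self hb⟩, (hA x).quotMul_quotMul hb,
      (hA x).quotForm_quotForm hb⟩
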